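/- Let $F_1(x_0,x_1,x_2)$ and $F_2(y_0,y_1,y_2)$ be homogeneous polynomials of degree $3$ with complex coefficients such that the cubic fourfold $$X=\{[x_0:x_1:x_2:y_0:y_1:y_2]\in\mathbb P^5(\mathbb C)\;:\;F_1(x_0,x_1,x_2)=F_2(y_0,y_1,y_2)\}$$ is smooth. Write $F\sim G$ if there is $g\in \mathrm{GL}_3(\mathbb C)$ with $F(g\cdot x)=G(x)$, and let $C_i\subset\mathbb P^2(\mathbb C)$ be the plane cubic curve $F_i=0$. (1) If $F_1\sim F_2$, then $C_1$ and $C_2$ are elliptic curves with a common $j$-invariant $j$, and the number of planes (two-dimensional projective linear subspaces of $\mathbb P^5(\mathbb C)$) contained in $X$ is exactly $$\begin{cases}243+162 & \text{if } j=0,\\ 243+108 & \text{if } j=1728,\\ 243+54 & \text{if } j\neq 0,1728,\end{cases}$$ where $j$ is the $j$-invariant of a Weierstrass equation to which $F_1$ (equivalently $F_2$) can be brought by a linear change of coordinates. (2) If $F_1\not\sim F_2$, then $X$ contains exactly $243$ planes. In particular, for $H(x_0,x_1,x_2)=x_0^3+x_1^3+x_2^3-3(1+\sqrt3)\,x_0x_1x_2$,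 the plane cubic $H=0$ has $j$-invariant $1728$, and $H(x)=H(y)$ defines an explicit smooth cubic fourfold containing exactly $351$ planes. -/

import Mathlib

namespace CubicFourfold

open MvPolynomial

/-- The zero locus in projective space of a homogeneous polynomial `G`: the points of
`ℙ(ℂ^σ)` all of whose representatives are zeros of `G`. -/
def zeroLocus {σ : Type} (G : MvPolynomial σ ℂ) : Set (Projectivization ℂ (σ → ℂ)) :=
  {p | ∀ v ∈ p.submodule, eval v G = 0}

/-- The projective hypersurface defined by the homogeneous polynomial `G` is smooth
(Jacobian criterion): the first partial derivatives of `G` have no common zero on it. -/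
def IsSmoothHypersurface {σ : Type} (G : MvPolynomial σ ℂ) : Prop :=
  ∀ v : σ → ℂ, v ≠ 0 → eval v G = 0 → ∃ i : σ, eval v (pderiv i G) ≠ 0

/-- The set of planes (two-dimensional projective linear subspaces, that is, those whose
underlying vector subspace has dimension three) contained in a set of points of a
projective space. -/
def planesIn {σ : Type} (X : Set (Projectivization ℂ (σ → ℂ))) :
    Set (Projectivization.Subspace ℂ (σ → ℂ)) :=
  {S | Module.finrank ℂ (Projectivization.Subspace.submodule S) = 3 ∧
    (S : Set (Projectivization ℂ (σ → ℂ))) ⊆ X}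

/-- The polynomial `F₁(x₀, x₁, x₂) - F₂(y₀, y₁, y₂)` in the six variables
`x₀, x₁, x₂` (left summand) and `y₀, y₁, y₂` (right summand). -/
noncomputable def diffPoly (F₁ F₂ : MvPolynomial (Fin 3) ℂ) :
    MvPolynomial (Fin 3 ⊕ Fin 3) ℂ :=
  rename Sum.inl F₁ - rename Sum.inr F₂

/-- `F ∼ G`: there is `g ∈ GL₃(ℂ)` with `F(g · x) = G(x)`. -/
def Equivalent (F G : MvPolynomial (Fin 3) ℂ) : Prop :=
  ∃ g : GL (Fin 3) ℂ, ∀ x : Fin 3 → ℂ,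
    eval ((g : Matrix (Fin 3) (Fin 3) ℂ).mulVec x) F = eval x G

/-- `j` is the `j`-invariant of the plane cubic curve `F = 0`, regarded as an elliptic curve:
a linear change of coordinates brings `F` to the homogeneous Weierstrass equation of an
elliptic curve whose `j`-invariant is `j`. (Over `ℂ` a nonzero constant factor of `F` is
absorbed in the change of coordinates, so this says that the two curves are projectively
equivalent.) -/
def IsJInvariant (F : MvPolynomial (Fin 3) ℂ) (j : ℂ) : Prop :=
  ∃ (W : WeierstrassCurve ℂ) (_ : W.IsElliptic),
    Equivalent F W.toProjective.polynomial ∧ W.j = j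

/-- The Hesse normal form `x₀³ + x₁³ + x₂³ - 3 c x₀ x₁ x₂`. -/
noncomputable def hesse (c : ℂ) : MvPolynomial (Fin 3) ℂ :=
  X 0 ^ 3 + X 1 ^ 3 + X 2 ^ 3 - C (3 * c) * X 0 * X 1 * X 2

end CubicFourfold

/-!
A plane in `F₁(x) = F₂(y)` is a three-dimensional subspace `V` of `ℂ³ × ℂ³` on which
`F₁ x = F₂ y`. If `V` meets neither factor, it is the graph of a linear isomorphism carrying `F₁`
to `F₂`. If it meets one factor, smoothness makes it meet both, each in a line, since a smooth
plane cubic contains no line; translating along these lines shows that `F₁` and `F₂` restrict to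
cubes of linear forms on the two-dimensional projections of `V`. These projections are thus flex
tangents, and `V` is determined by a flex of each curve and a cube root of unity
(`mem_planeSet_cases`). As there are nine flexes on each curve, the number of planes is `9 · 9 · 3`
plus the number of isomorphisms (`ncard_planeSet`).

A flex exists because a cubic form and its Hessian determinant have a common zero other than the
origin, by Krull's height theorem and the Nullstellensatz (`exists_flexFrame`). A flex gives a short
Weierstrass form `y² z - x³ - a x z² - b z³` (`SmoothCubic.exists_short`), on which the finite flexes
are the points over the four roots of the division polynomial `ψ₃` (`hasNineFlexes_short`).

If `F₁ ∼ F₂`, the isomorphisms are as many as the linear automorphisms of `F₁`. These act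
transitively on the flexes: the involution `y ↦ -y` of a Weierstrass form based at the third point
of the line through two flexes exchanges the two (`SmoothCubic.exists_isos_map_flex`). The
stabilizer of the point at infinity is diagonal and is counted directly; its order is `18` if
`a = 0`, `12` if `b = 0` and `6` otherwise, and `a = 0`, `b = 0` mean `j = 0`, `j = 1728`
(`natCard_isos_short`, `natCard_isos_of_isJInvariant`).
-/

namespace CubicFourfold

open MvPolynomial

/-! ### Polarization of ternary cubics -/

/-- The vector space `ℂ³`. -/
abbrev E3 : Type := Fin 3 → ℂ

/-- `B` is a symmetric trilinear form with `F x = B x x x`, i.e. the polarization of the cubic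
form `F`. -/
structure IsPolarization (B : E3 →ₗ[ℂ] E3 →ₗ[ℂ] E3 →ₗ[ℂ] ℂ) (F : E3 → ℂ) : Prop where
  swap_left : ∀ u v w, B u v w = B v u w
  swap_right : ∀ u v w, B u v w = B u w v
  diag : ∀ x, F x = B x x x

/-- Polarization of a homogeneous cubic polynomial, together with its first and second partial
derivatives: this is Euler's identity applied three times. -/
theorem exists_isPolarization {F : MvPolynomial (Fin 3) ℂ} (hF : F.IsHomogeneous 3) :
    ∃ B, IsPolarization B (fun x => eval x F) ∧
      (∀ x i, eval x (pderiv i F) = 3 * B x x (Pi.single i 1)) ∧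
      ∀ x i j, eval x (pderiv i (pderiv j F)) = 6 * B x (Pi.single i 1) (Pi.single j 1) := by
  have h3 : ∀ i j k, ∃ t : ℂ, pderiv k (pderiv j (pderiv i F)) = C t := by
    intro i j k
    have h : (pderiv k (pderiv j (pderiv i F))).IsHomogeneous 0 := hF.pderiv.pderiv.pderiv
    exact ⟨_, totalDegree_eq_zero_iff_eq_C.mp ((totalDegree_zero_iff_isHomogeneous _).mpr h)⟩
  choose T hT using h3
  have hcomm : ∀ (G : MvPolynomial (Fin 3) ℂ) i j,
      pderiv i (pderiv j G) = pderiv j (pderiv i G) := by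
    intro G i j
    have := congrArg (fun D : Derivation ℂ (MvPolynomial (Fin 3) ℂ) _ => D G)
      (show ⁅pderiv i, pderiv j⁆ = (0 : Derivation ℂ (MvPolynomial (Fin 3) ℂ) _) from by
        apply MvPolynomial.derivation_ext
        intro k
        rw [Derivation.commutator_apply, pderiv_X, pderiv_X, Pi.single_apply, Pi.single_apply]
        split_ifs <;> simp)
    simpa [Derivation.commutator_apply, sub_eq_zero] using this
  have hT1 : ∀ i j k, T i j k = T j i k := fun i j k => by
    apply C_injective (Fin 3) ℂ
    rw [← hT, ← hT, hcomm F]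
  have hT2 : ∀ i j k, T i j k = T i k j := fun i j k => by
    apply C_injective (Fin 3) ℂ
    rw [← hT, ← hT, hcomm (pderiv i F)]
  have e2 : ∀ x i j, eval x (pderiv j (pderiv i F)) = ∑ k, x k * T i j k := by
    intro x i j
    have := congrArg (eval x) ((hF.pderiv (i := i)).pderiv (i := j)).sum_X_mul_pderiv
    simpa [hT] using this.symm
  have e1 : ∀ x i, 2 * eval x (pderiv i F) = ∑ j, x j * ∑ k, x k * T i j k := by
    intro x i
    have := congrArg (eval x) (hF.pderiv (i := i)).sum_X_mul_pderiv
    simpa [e2] using this.symm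
  have e0 : ∀ x, 3 * eval x F = ∑ i, x i * eval x (pderiv i F) := by
    intro x
    have := congrArg (eval x) hF.sum_X_mul_pderiv
    simpa using this.symm
  let B : E3 →ₗ[ℂ] E3 →ₗ[ℂ] E3 →ₗ[ℂ] ℂ := ∑ i, ∑ j, ∑ k, (T i j k / 6) •
    (LinearMap.proj (R := ℂ) (φ := fun _ : Fin 3 => ℂ) i).smulRight
      ((LinearMap.proj (R := ℂ) (φ := fun _ : Fin 3 => ℂ) j).smulRight
        (LinearMap.proj (R := ℂ) (φ := fun _ : Fin 3 => ℂ) k))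
  have hB : ∀ u v w, B u v w = ∑ i, ∑ j, ∑ k, T i j k / 6 * (u i * (v j * w k)) := by
    intro u v w
    simp [B, LinearMap.sum_apply]
  refine ⟨B, ⟨?_, ?_, ?_⟩, ?_, ?_⟩
  · intro u v w
    rw [hB, hB, Finset.sum_comm]
    refine Finset.sum_congr rfl fun i _ => Finset.sum_congr rfl fun j _ =>
      Finset.sum_congr rfl fun k _ => ?_
    rw [hT1]; ring
  · intro u v w
    rw [hB, hB]
    refine Finset.sum_congr rfl fun i _ => ?_
    rw [Finset.sum_comm]
    refine Finset.sum_congr rfl fun j _ => Finset.sum_congr rfl fun k _ => ?_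
    rw [hT2]; ring
  · intro x
    rw [hB]
    have h : 6 * eval x F = ∑ i, x i * ∑ j, x j * ∑ k, x k * T i j k := by
      simp_rw [← e1]
      calc _ = 2 * (3 * eval x F) := by ring
        _ = _ := by rw [e0, Finset.mul_sum]; exact Finset.sum_congr rfl fun i _ => by ring
    have h' : eval x F = (1 / 6) * (6 * eval x F) := by ring
    rw [h', h]
    simp only [Finset.mul_sum]
    refine Finset.sum_congr rfl fun i _ => Finset.sum_congr rfl fun j _ =>
      Finset.sum_congr rfl fun k _ => ?_
    ring
  · intro x i
    rw [hB, show eval x (pderiv i F) = 1 / 2 * (2 * eval x (pderiv i F)) by ring, e1]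
    simp only [Finset.mul_sum, Pi.single_apply, mul_ite, mul_one, mul_zero, Finset.sum_ite_eq',
      Finset.mem_univ, if_true]
    refine Finset.sum_congr rfl fun j _ => Finset.sum_congr rfl fun k _ => ?_
    rw [hT1 i j k, hT2 j i k]; ring
  · intro x i j
    rw [hB, e2]
    simp only [Finset.mul_sum, Pi.single_apply, mul_ite, mul_one, mul_zero,
      Finset.sum_ite_eq', Finset.mem_univ, if_true]
    refine Finset.sum_congr rfl fun k _ => ?_
    rw [hT2 j i k, hT1 j k i, hT2 k j i]; ring

/-- `F` is a cubic form on `ℂ³` defining a smooth plane curve: it has a polarization `B`, and the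
gradient `3 B(v, v, ·)` vanishes only at `v = 0`. -/
def SmoothCubic (F : E3 → ℂ) : Prop :=
  ∃ B, IsPolarization B F ∧ ∀ v, (∀ w, B v v w = 0) → v = 0

theorem IsPolarization.expand {B : E3 →ₗ[ℂ] E3 →ₗ[ℂ] E3 →ₗ[ℂ] ℂ} {F : E3 → ℂ}
    (hB : IsPolarization B F) (s t : ℂ) (u v : E3) :
    F (s • u + t • v) = s ^ 3 * B u u u + 3 * s ^ 2 * t * B u u v + 3 * s * t ^ 2 * B u v v +
      t ^ 3 * B v v v := by
  rw [hB.diag]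
  simp only [map_add, map_smul, LinearMap.add_apply, LinearMap.smul_apply, smul_eq_mul]
  rw [hB.swap_left v u u, hB.swap_right u v u, hB.swap_left v u v, hB.swap_right v v u,
    hB.swap_left v u v]
  ring

theorem IsPolarization.expand₃ {B : E3 →ₗ[ℂ] E3 →ₗ[ℂ] E3 →ₗ[ℂ] ℂ} {F : E3 → ℂ}
    (hB : IsPolarization B F) (s t z : ℂ) (u v w : E3) :
    F (s • u + t • v + z • w) = F (s • u + t • v) + z * (3 * s ^ 2 * B u u w +
      6 * s * t * B u v w + 3 * t ^ 2 * B v v w + 3 * s * z * B u w w + 3 * t * z * B v w w +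
      z ^ 2 * B w w w) := by
  rw [hB.expand, hB.diag]
  simp only [map_add, map_smul, LinearMap.add_apply, LinearMap.smul_apply, smul_eq_mul]
  rw [hB.swap_left v u u, hB.swap_right u v u, hB.swap_left v u v, hB.swap_right v v u,
    hB.swap_left v u v, hB.swap_left w u u, hB.swap_right u w u, hB.swap_left w v v,
    hB.swap_right v w v, hB.swap_left w u w, hB.swap_right w w u, hB.swap_left w u w,
    hB.swap_left w v w, hB.swap_right w w v, hB.swap_left w v w, hB.swap_left v u w,
    hB.swap_left w u v, hB.swap_right u w v, hB.swap_left w v u, hB.swap_right v w u,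
    hB.swap_left v u w]
  ring

/-- A criterion, free of derivatives, for `v` to be a singular point of the cubic form `F`:
along every line through `v` the form vanishes to second order. -/
def IsSingularAt (F : E3 → ℂ) (v : E3) : Prop :=
  ∀ w, ∃ c d : ℂ, ∀ t : ℂ, F (v + t • w) = c * t ^ 2 + d * t ^ 3

theorem SmoothCubic.eq_zero_of_isSingularAt {F : E3 → ℂ} (hF : SmoothCubic F) {v : E3}
    (hv : IsSingularAt F v) : v = 0 := by
  obtain ⟨B, hB, h⟩ := hF
  refine h v fun w => ?_
  obtain ⟨c, d, hcd⟩ := hv w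
  have key : ∀ t : ℂ, B v v v + 3 * t * B v v w + 3 * t ^ 2 * B v w w + t ^ 3 * B w w w =
      c * t ^ 2 + d * t ^ 3 := fun t => by
    rw [← hcd t]
    have := hB.expand 1 t v w
    rw [one_smul] at this
    rw [this]; ring
  -- interpolation at `t = 0, 1, -1, 2` isolates the coefficient of `t`
  linear_combination (-1 / 18 : ℂ) * (key 2 - 3 * key 0 - 4 * ((key 1 + key (-1) - 2 * key 0) / 2)
    - 8 * ((key 1 - key (-1)) / 2) + 2 * key 0)

/-- Over `ℂ` a binary quadratic form has a nontrivial zero. -/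
theorem exists_binary_quadratic_zero (a b c : ℂ) :
    ∃ s t : ℂ, (s ≠ 0 ∨ t ≠ 0) ∧ a * s ^ 2 + b * s * t + c * t ^ 2 = 0 := by
  by_cases ha : a = 0
  · exact ⟨1, 0, Or.inl one_ne_zero, by simp [ha]⟩
  · obtain ⟨r, hr⟩ := IsAlgClosed.exists_pow_nat_eq (discrim a b c) (n := 2) two_pos
    obtain ⟨x, hx⟩ := exists_quadratic_eq_zero ha ⟨r, by rw [← hr, sq]⟩
    exact ⟨x, 1, Or.inr one_ne_zero, by linear_combination hx⟩

/-- Two independent vectors of `ℂ³` extend to a basis. -/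
theorem exists_third_vector {p q : E3} (h : LinearIndependent ℂ ![p, q]) :
    ∃ r, (∀ v : E3, ∃ x y z : ℂ, v = x • p + y • q + z • r) ∧
      ∀ x y z : ℂ, x • p + y • q + z • r = 0 → x = 0 ∧ y = 0 ∧ z = 0 := by
  have hlt : Submodule.span ℂ (Set.range ![p, q]) < ⊤ := by
    rw [lt_top_iff_ne_top]
    intro htop
    have h1 := finrank_span_eq_card h
    rw [htop, finrank_top] at h1
    simp at h1
  obtain ⟨r, -, hr⟩ := SetLike.exists_of_lt hlt
  have hind : LinearIndependent ℂ ![r, p, q] := by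
    exact linearIndependent_finCons.mpr ⟨h, hr⟩
  have hspan := hind.span_eq_top_of_card_eq_finrank' (by simp)
  refine ⟨r, fun v => ?_, fun x y z hxyz => ?_⟩
  · have hv : v ∈ Submodule.span ℂ (Set.range ![r, p, q]) := by rw [hspan]; trivial
    obtain ⟨c, hc⟩ := (Submodule.mem_span_range_iff_exists_fun ℂ).mp hv
    refine ⟨c 1, c 2, c 0, ?_⟩
    rw [← hc, Fin.sum_univ_three]
    simp only [Matrix.cons_val]
    abel
  · have := Fintype.linearIndependent_iff.mp hind ![z, x, y] (by
      rw [Fin.sum_univ_three]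
      simp only [Matrix.cons_val]
      rw [← hxyz]; abel)
    exact ⟨this 1, this 2, this 0⟩

/-- A smooth plane cubic contains no line: on a line `F = 0` the gradient is a quadratic form
times a fixed linear form, so it would vanish somewhere. -/
theorem SmoothCubic.not_line {F : E3 → ℂ} (hF : SmoothCubic F) {p q : E3}
    (h : LinearIndependent ℂ ![p, q]) : ¬ ∀ s t : ℂ, F (s • p + t • q) = 0 := by
  intro h0
  obtain ⟨B, hB, hs⟩ := hF
  simp only [hB.expand] at h0
  have a1 : B p p p = 0 := by linear_combination h0 1 0
  have a2 : B q q q = 0 := by linear_combination h0 0 1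
  have a3 : B p p q = 0 := by linear_combination (h0 1 1 - h0 1 (-1)) / 6 - a2 / 3
  have a4 : B p q q = 0 := by linear_combination (h0 1 1 + h0 1 (-1)) / 6 - a1 / 3
  obtain ⟨r, hr, -⟩ := exists_third_vector h
  obtain ⟨s, t, hst, hq⟩ := exists_binary_quadratic_zero (B p p r) (2 * B p q r) (B q q r)
  have hv := hs (s • p + t • q) fun w => by
    obtain ⟨x, y, z, rfl⟩ := hr w
    simp only [map_add, map_smul, LinearMap.add_apply, LinearMap.smul_apply, smul_eq_mul,
      hB.swap_left q p, hB.swap_right p q p, hB.swap_right q q p, a1, a2, a3, a4]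
    linear_combination z * hq
  have := LinearIndependent.pair_iff.mp h s t hv
  tauto

/-! ### Existence of flexes -/

/-- A flex of `F = 0` in linear coordinates: `p` spans the flex point, `p` and `q` span the
flex tangent line, and `F` restricted to that line is the cube of the linear form with
`p ↦ 0`, `q ↦ 1`. -/
def FlexFrame (F : E3 → ℂ) (p q : E3) : Prop :=
  LinearIndependent ℂ ![p, q] ∧ ∀ s t : ℂ, F (s • p + t • q) = t ^ 3

/-- The ideal of the origin of `ℂ³` has height at least three: it contains the chain of the kernels
of the substitutions of `0` for the first one, two or three variables. -/
theorem three_le_height_ker_eval_zero :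
    3 ≤ (RingHom.ker (eval (0 : E3))).height := by
  let φ : Fin 3 → (MvPolynomial (Fin 3) ℂ →+* MvPolynomial (Fin 3) ℂ) := fun n =>
    (aeval (fun i : Fin 3 => if i ≤ n then (0 : MvPolynomial (Fin 3) ℂ) else X i)).toRingHom
  have hφ : ∀ n i, φ n (X i) = if i ≤ n then 0 else X i := fun n i => by simp [φ]
  have hcomp : ∀ n m, n ≤ m → ∀ P, φ n P = 0 → φ m P = 0 := by
    intro n m hnm P hP
    have : (φ m).comp (φ n) = φ m := by
      apply MvPolynomial.ringHom_ext
      · intro r; simp [φ]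
      · intro i
        rw [RingHom.comp_apply, hφ]
        split_ifs with h
        · rw [map_zero, hφ, if_pos (h.trans hnm)]
        · rfl
    rw [← this, RingHom.comp_apply, hP, map_zero]
  have hlt : ∀ n m, n < m → RingHom.ker (φ n) < RingHom.ker (φ m) := by
    intro n m hnm
    refine lt_of_le_of_ne (fun P hP => hcomp n m hnm.le P hP) fun heq => ?_
    have h1 : (X m : MvPolynomial (Fin 3) ℂ) ∈ RingHom.ker (φ m) := by
      rw [RingHom.mem_ker, hφ, if_pos le_rfl]
    rw [← heq, RingHom.mem_ker, hφ, if_neg (not_le.mpr hnm)] at h1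
    exact X_ne_zero m h1
  have hbot : (⊥ : Ideal (MvPolynomial (Fin 3) ℂ)) < RingHom.ker (φ 0) := by
    rw [bot_lt_iff_ne_bot]
    intro h
    have h1 : (X 0 : MvPolynomial (Fin 3) ℂ) ∈ RingHom.ker (φ 0) := by
      rw [RingHom.mem_ker, hφ, if_pos le_rfl]
    rw [h, Ideal.mem_bot] at h1
    exact X_ne_zero 0 h1
  have hle : RingHom.ker (φ 2) ≤ RingHom.ker (eval (0 : E3)) := by
    intro P hP
    have : (eval (0 : E3)).comp (φ 2) = eval (0 : E3) := by
      apply MvPolynomial.ringHom_ext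
      · intro r; simp [φ]
      · intro i; rw [RingHom.comp_apply, hφ]; split_ifs <;> simp
    rw [RingHom.mem_ker, ← this, RingHom.comp_apply, RingHom.mem_ker.mp hP, map_zero]
  have hp : ∀ n, (RingHom.ker (φ n)).IsPrime := fun n => RingHom.ker_isPrime _
  have a0 := Ideal.height_add_one_le_of_lt_of_isPrime hbot
  have a1 := Ideal.height_add_one_le_of_lt_of_isPrime (hlt 0 1 (by decide))
  have a2 := Ideal.height_add_one_le_of_lt_of_isPrime (hlt 1 2 (by decide))
  have a3 := Ideal.height_mono hle
  calc (3 : ℕ∞) = 0 + 1 + 1 + 1 := by norm_num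
    _ ≤ (⊥ : Ideal (MvPolynomial (Fin 3) ℂ)).height + 1 + 1 + 1 := by gcongr; exact zero_le
    _ ≤ _ := by
      refine le_trans ?_ (a2.trans a3)
      gcongr
      refine le_trans ?_ a1
      gcongr

/-- Two polynomials in three variables vanishing at the origin have another common zero: otherwise
the Nullstellensatz makes the ideal of the origin minimal over an ideal with two generators,
so that its height is at most two by Krull's theorem. -/
theorem exists_common_zero {F G : MvPolynomial (Fin 3) ℂ} (hF : eval (0 : E3) F = 0)
    (hG : eval (0 : E3) G = 0) : ∃ v : E3, v ≠ 0 ∧ eval v F = 0 ∧ eval v G = 0 := by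
  by_contra hcon
  push Not at hcon
  set I := Ideal.span ({F, G} : Set (MvPolynomial (Fin 3) ℂ))
  have hI : I ≤ RingHom.ker (eval (0 : E3)) := by
    rw [Ideal.span_le]
    rintro P (rfl | rfl)
    · exact hF
    · exact hG
  have hrad : I.radical = RingHom.ker (eval (0 : E3)) := by
    rw [← MvPolynomial.vanishingIdeal_zeroLocus_eq_radical (K := ℂ)]
    ext P
    rw [mem_vanishingIdeal_iff, RingHom.mem_ker]
    constructor
    · intro h
      have := h 0 (by
        rw [mem_zeroLocus_iff]
        intro Q hQ
        rw [aeval_eq_eval]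
        exact hI hQ)
      rwa [aeval_eq_eval] at this
    · intro h v hv
      rw [mem_zeroLocus_iff] at hv
      have h1 := hv F (Ideal.subset_span (by simp))
      have h2 := hv G (Ideal.subset_span (by simp))
      rw [aeval_eq_eval] at h1 h2
      have : v = 0 := by
        by_contra hne
        exact hcon v hne h1 h2
      rw [this, aeval_eq_eval]; exact h
  have hprime : (RingHom.ker (eval (0 : E3))).IsPrime := RingHom.ker_isPrime _
  have hmin : RingHom.ker (eval (0 : E3)) ∈ I.minimalPrimes := by
    rw [← Ideal.radical_minimalPrimes, hrad, Ideal.minimalPrimes_eq_subsingleton_self]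
    rfl
  have h2 := Ideal.height_le_card_of_mem_minimalPrimes_span (Set.toFinite _) hmin
  have h3 := three_le_height_ker_eval_zero.trans h2
  have h4 : ({F, G} : Set (MvPolynomial (Fin 3) ℂ)).ncard ≤ 2 := Set.ncard_insert_le _ _ |>.trans
    (by simp)
  have h5 : (3 : ℕ∞) ≤ (2 : ℕ) := h3.trans (by exact_mod_cast h4)
  exact absurd h5 (by decide)

/-- A smooth plane cubic has a flex: a zero `v` of `F` and of its Hessian determinant, whose
Hessian matrix has a kernel vector `w`; then `F (s v + t w) = t³ F w`. -/
theorem exists_flexFrame {F : MvPolynomial (Fin 3) ℂ} (hF : F.IsHomogeneous 3)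
    (hs : SmoothCubic (fun x => eval x F)) : ∃ p q, FlexFrame (fun x => eval x F) p q := by
  obtain ⟨B, hB, -, h2⟩ := exists_isPolarization hF
  let H : Matrix (Fin 3) (Fin 3) (MvPolynomial (Fin 3) ℂ) :=
    Matrix.of fun i j => pderiv i (pderiv j F)
  have hH : ∀ x, eval x H.det = (Matrix.of fun i j : Fin 3 =>
      6 * B x (Pi.single i 1) (Pi.single j 1)).det := by
    intro x
    rw [RingHom.map_det]
    congr 1
    ext i j
    simp [H, h2]
  have hB0 := hB.diag 0
  simp only [map_zero] at hB0
  obtain ⟨v, hv, hFv, hHv⟩ := exists_common_zero (F := F) (G := H.det) hB0 (by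
    rw [hH]
    simp only [map_zero, LinearMap.zero_apply, mul_zero]
    exact Matrix.det_zero)
  rw [hH] at hHv
  obtain ⟨w, hw, hw0⟩ := Matrix.exists_mulVec_eq_zero_iff.mpr hHv
  have hpi : ∀ u : E3, u = ∑ j, u j • (Pi.single j (1 : ℂ) : E3) := fun u => by
    ext k; simp [Finset.sum_apply, Pi.single_apply]
  have hker : ∀ u, B v w u = 0 := by
    intro u
    have h : ∀ i, B v w (Pi.single i 1) = 0 := by
      intro i
      have := congrFun hw0 i
      simp only [Matrix.mulVec, dotProduct, Matrix.of_apply, Pi.zero_apply] at this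
      rw [hB.swap_right, hpi w, map_sum]
      simp only [map_smul, smul_eq_mul]
      have h6 : (6 : ℂ) * ∑ j, w j * B v (Pi.single i 1) (Pi.single j 1) = 0 := by
        rw [← this, Finset.mul_sum]
        exact Finset.sum_congr rfl fun j _ => by ring
      simpa using h6
    rw [hpi u, map_sum]
    simp [h]
  have hexp : ∀ s t : ℂ, eval (s • v + t • w) F = t ^ 3 * eval w F := by
    intro s t
    have h1 := hB.expand s t v w
    have h2 := hB.diag w
    have h3 := hB.diag v
    beta_reduce at h1 h2 h3
    rw [h1, ← h2, ← h3, hFv, hker w, hB.swap_right v v w, hker v]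
    ring
  have hind : LinearIndependent ℂ ![v, w] := by
    rw [LinearIndependent.pair_iff' hv]
    intro a ha
    have ha0 : a ≠ 0 := by rintro rfl; simp at ha; exact hw ha.symm
    refine hv (hs.eq_zero_of_isSingularAt fun u => ⟨3 * B v u u, B u u u, fun t => ?_⟩)
    have h1 := hB.expand 1 t v u
    have h3 := hB.diag v
    have h4 := hker u
    rw [← ha, map_smul, LinearMap.smul_apply, smul_eq_mul, mul_eq_zero] at h4
    rw [one_smul] at h1
    beta_reduce at h1 h3 ⊢
    rw [h1, h4.resolve_left ha0, ← h3]
    rw [hFv]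
    ring
  have hFw : eval w F ≠ 0 := by
    intro h
    exact hs.not_line hind fun s t => by simp only [hexp, h, mul_zero]
  obtain ⟨c, hc⟩ := IsAlgClosed.exists_pow_nat_eq (eval w F) (n := 3) (by norm_num)
  have hc0 : c ≠ 0 := by rintro rfl; exact hFw (by rw [← hc]; norm_num)
  refine ⟨v, c⁻¹ • w, ?_, fun s t => ?_⟩
  · rw [LinearIndependent.pair_iff] at hind ⊢
    intro s t hst
    rw [smul_smul] at hst
    have := hind _ _ hst
    simpa [hc0] using this
  · simp only [smul_smul, hexp, ← hc]
    field_simp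

/-! ### Short Weierstrass forms -/

/-- The linear isomorphisms carrying the form `F` to the form `G`. -/
def Isos (F G : E3 → ℂ) : Set (E3 ≃ₗ[ℂ] E3) := {e | ∀ x, G (e x) = F x}

theorem isos_symm {F G : E3 → ℂ} {e : E3 ≃ₗ[ℂ] E3} (he : e ∈ Isos F G) : e.symm ∈ Isos G F :=
  fun x => by rw [← he, e.apply_symm_apply]

theorem isos_trans {F G H : E3 → ℂ} {e f : E3 ≃ₗ[ℂ] E3} (he : e ∈ Isos F G)
    (hf : f ∈ Isos G H) : e.trans f ∈ Isos F H :=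
  fun x => by rw [LinearEquiv.trans_apply, hf, he]

theorem flexFrame_of_isos {F G : E3 → ℂ} {e : E3 ≃ₗ[ℂ] E3} (he : e ∈ Isos F G) {p q : E3}
    (h : FlexFrame F p q) : FlexFrame G (e p) (e q) := by
  refine ⟨?_, fun s t => ?_⟩
  · have := h.1
    rw [LinearIndependent.pair_iff] at this ⊢
    intro s t hst
    refine this s t (e.injective ?_)
    simpa using hst
  · rw [← h.2 s t, ← he]
    simp

theorem isSingularAt_of_isos {F G : E3 → ℂ} {e : E3 ≃ₗ[ℂ] E3} (he : e ∈ Isos F G) {v : E3}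
    (h : IsSingularAt F v) : IsSingularAt G (e v) := by
  intro w
  obtain ⟨c, d, hcd⟩ := h (e.symm w)
  refine ⟨c, d, fun t => ?_⟩
  rw [← hcd t, ← he]
  simp

/-- Pre- and postcomposition with fixed isomorphisms. -/
theorem natCard_isos_congr {F F' G G' : E3 → ℂ} {e f : E3 ≃ₗ[ℂ] E3} (he : e ∈ Isos F F')
    (hf : f ∈ Isos G G') : Nat.card (Isos F G) = Nat.card (Isos F' G') :=
  Nat.card_congr
    { toFun := fun g => ⟨(e.symm.trans g.1).trans f, isos_trans (isos_trans (isos_symm he) g.2) hf⟩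
      invFun := fun g => ⟨(e.trans g.1).trans f.symm, isos_trans (isos_trans he g.2) (isos_symm hf)⟩
      left_inv := fun g => by ext; simp
      right_inv := fun g => by ext; simp }

/-- The homogeneous short Weierstrass form `y² z - x³ - a x z² - b z³`. -/
def short (a b : ℂ) (x : E3) : ℂ :=
  x 1 ^ 2 * x 2 - x 0 ^ 3 - a * x 0 * x 2 ^ 2 - b * x 2 ^ 3

/-- The point at infinity of a Weierstrass cubic. -/
def infty : E3 := ![0, 1, 0]

/-- If `4a³ + 27b² = 0`, then `x³ + a x + b` has a double root `r`, and `(r, 0, 1)` is singular. -/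
theorem exists_isSingularAt_short {a b : ℂ} (h : 4 * a ^ 3 + 27 * b ^ 2 = 0) :
    ∃ v : E3, v ≠ 0 ∧ IsSingularAt (short a b) v := by
  obtain ⟨r, hr, hr'⟩ : ∃ r : ℂ, r ^ 3 + a * r + b = 0 ∧ 3 * r ^ 2 + a = 0 := by
    by_cases ha : a = 0
    · have hb : b = 0 := by simpa [ha] using h
      exact ⟨0, by simp [hb], by simp [ha]⟩
    · refine ⟨-3 * b / (2 * a), ?_, ?_⟩
      · field_simp
        linear_combination (-b) * h
      · field_simp
        linear_combination h
  refine ⟨![r, 0, 1], fun h0 => by simpa using congrFun h0 2, fun w =>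
    ⟨w 1 ^ 2 - 3 * r * w 0 ^ 2 - 2 * a * w 0 * w 2 - a * r * w 2 ^ 2 - 3 * b * w 2 ^ 2,
      w 1 ^ 2 * w 2 - w 0 ^ 3 - a * w 0 * w 2 ^ 2 - b * w 2 ^ 3, fun t => ?_⟩⟩
  simp only [short, Pi.add_apply, Pi.smul_apply, smul_eq_mul, Matrix.cons_val]
  linear_combination (-1 - 3 * t * w 2) * hr + (-t * w 0 + r * t * w 2) * hr'

/-- A smooth plane cubic with a flex has a short Weierstrass form with the flex at infinity.
In a basis starting with the flex frame, `F = x³ + z · (quadratic)`; smoothness at the flex makes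
the coefficient `A` of `y² z` nonzero, so that completing the square and the cube is possible. -/
theorem SmoothCubic.exists_short {F : E3 → ℂ} (hF : SmoothCubic F) {p q : E3}
    (h : FlexFrame F p q) : ∃ a b : ℂ, 4 * a ^ 3 + 27 * b ^ 2 ≠ 0 ∧
      ∃ e ∈ Isos F (short a b), ∃ c : ℂ, c ≠ 0 ∧ e p = c • infty := by
  obtain ⟨B, hB, hs⟩ := id hF
  obtain ⟨r, hr, hr0⟩ := exists_third_vector h.1
  have hp0 : p ≠ 0 := h.1.ne_zero 0
  have hexp := hB.expand
  have b0 : B p p p = 0 := by linear_combination h.2 1 0 - hexp 1 0 p q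
  have b3 : B q q q = 1 := by linear_combination h.2 0 1 - hexp 0 1 p q
  have b1 : B p p q = 0 := by
    linear_combination (h.2 1 1 - hexp 1 1 p q - h.2 1 (-1) + hexp 1 (-1) p q) / 6 - b3 / 3
  have hA : B p p r ≠ 0 := by
    intro hA
    refine hp0 (hs p fun w => ?_)
    obtain ⟨x, y, z, rfl⟩ := hr w
    simp [b0, b1, hA]
  obtain ⟨A, hAdef⟩ : ∃ A, A = 3 * B p p r := ⟨_, rfl⟩
  have hA0 : A ≠ 0 := by rw [hAdef]; exact mul_ne_zero (by norm_num) hA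
  obtain ⟨k, hk⟩ := IsAlgClosed.exists_pow_nat_eq A (n := 2) two_pos
  have hk0 : k ≠ 0 := by rintro rfl; exact hA0 (by rw [← hk]; norm_num)
  have hF3 : ∀ x y z : ℂ, F (y • p + x • q + z • r) = x ^ 3 + z * (A * y ^ 2 +
      (6 * B p q r) * x * y + (3 * B p r r) * y * z + (3 * B q q r) * x ^ 2 +
      (3 * B q r r) * x * z + B r r r * z ^ 2) := by
    intro x y z
    rw [hB.expand₃, h.2, hAdef]
    ring
  generalize 6 * B p q r = b at hF3
  generalize 3 * B p r r = c at hF3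
  generalize 3 * B q q r = d at hF3
  generalize 3 * B q r r = f at hF3
  generalize B r r r = g at hF3
  -- the substitution inverse to completing the square and the cube
  set d' := d - b ^ 2 / (4 * A) with hd'
  set f' := f - b * c / (2 * A) with hf'
  set g' := g - c ^ 2 / (4 * A) with hg'
  let M : E3 →ₗ[ℂ] E3 :=
    (LinearMap.proj (R := ℂ) (φ := fun _ : Fin 3 => ℂ) 0).smulRight ((b / (2 * A)) • p - q) +
    (LinearMap.proj (R := ℂ) (φ := fun _ : Fin 3 => ℂ) 1).smulRight (k⁻¹ • p) +
    (LinearMap.proj (R := ℂ) (φ := fun _ : Fin 3 => ℂ) 2).smulRight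
      ((b * d' / (6 * A) - c / (2 * A)) • p - (d' / 3) • q + r)
  have hM : ∀ x : E3, M x = (k⁻¹ * x 1 + b / (2 * A) * x 0 +
      (b * d' / (6 * A) - c / (2 * A)) * x 2) • p + (-x 0 - d' / 3 * x 2) • q + x 2 • r := by
    intro x
    simp only [M, LinearMap.add_apply, LinearMap.smulRight_apply, LinearMap.proj_apply]
    module
  have hinj : Function.Injective M := by
    rw [← LinearMap.ker_eq_bot, LinearMap.ker_eq_bot']
    intro x hx
    rw [hM] at hx
    obtain ⟨h1, h2, h3⟩ := hr0 _ _ _ hx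
    have h0 : x 0 = 0 := by linear_combination -h2 - d' / 3 * h3
    rw [h3, h0] at h1
    have h1' : x 1 = 0 := by simpa [hk0] using h1
    ext i
    fin_cases i
    · exact h0
    · exact h1'
    · exact h3
  obtain ⟨a, ha⟩ : ∃ a, a = d' ^ 2 / 3 - d' ^ 2 * 2 / 3 + f' := ⟨_, rfl⟩
  obtain ⟨b', hb'⟩ : ∃ b', b' = d' ^ 3 / 27 - d' ^ 3 / 9 + f' * d' / 3 - g' := ⟨_, rfl⟩
  have hiso : LinearEquiv.ofInjectiveEndo M hinj ∈ Isos (short a b') F := by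
    intro x
    rw [LinearEquiv.coe_ofInjectiveEndo, hM, hF3, short, ha, hb', hd', hf', hg', ← hk]
    field_simp
    ring
  -- a vanishing discriminant would yield a singular point of `F`
  have hdisc : 4 * a ^ 3 + 27 * b' ^ 2 ≠ 0 := by
    intro h0
    obtain ⟨v, hv, hsing⟩ := exists_isSingularAt_short h0
    exact hv ((LinearEquiv.map_eq_zero_iff _).mp
      (hF.eq_zero_of_isSingularAt (isSingularAt_of_isos hiso hsing)))
  refine ⟨a, b', hdisc, _, isos_symm hiso, k, hk0, ?_⟩
  rw [LinearEquiv.symm_apply_eq, map_smul, LinearEquiv.coe_ofInjectiveEndo, hM]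
  simp [infty, smul_smul, hk0]

/-! ### The nine flexes -/

/-- `F = 0` has exactly nine flexes: nine flex frames with distinct flex points, such that any
flex frame has the flex point and the flex tangent line of one of the nine. -/
def HasNineFlexes (F : E3 → ℂ) : Prop :=
  ∃ (ι : Type) (p q : ι → E3), Nat.card ι = 9 ∧ (∀ i, FlexFrame F (p i) (q i)) ∧
    (∀ i j (c : ℂ), p i = c • p j → i = j) ∧
    ∀ p' q', FlexFrame F p' q' → ∃ i, (∃ c : ℂ, p' = c • p i) ∧ ∃ c d : ℂ, q' = c • p i + d • q i

theorem HasNineFlexes.of_isos {F G : E3 → ℂ} {e : E3 ≃ₗ[ℂ] E3} (he : e ∈ Isos F G)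
    (h : HasNineFlexes G) : HasNineFlexes F := by
  obtain ⟨ι, p, q, hι, h1, h2, h3⟩ := h
  refine ⟨ι, fun i => e.symm (p i), fun i => e.symm (q i), hι,
    fun i => flexFrame_of_isos (isos_symm he) (h1 i), fun i j c hc => h2 i j c ?_,
    fun p' q' h' => ?_⟩
  · apply e.symm.injective
    rw [map_smul]
    exact hc
  · obtain ⟨i, ⟨c, hc⟩, d, f, hq⟩ := h3 _ _ (flexFrame_of_isos he h')
    refine ⟨i, ⟨c, ?_⟩, d, f, ?_⟩
    · rw [← map_smul, ← hc, e.symm_apply_apply]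
    · rw [← map_smul, ← map_smul, ← map_add, ← hq, e.symm_apply_apply]

/-- A flex frame `(P, Q)` of `short a b` with `P = (x, y, 1)` and `Q = (u, v, 0)`, in equations. -/
theorem flex_equations {a b x y u v : ℂ}
    (h : ∀ s t : ℂ, short a b (s • ![x, y, 1] + t • ![u, v, 0]) = t ^ 3) :
    y ^ 2 = x ^ 3 + a * x + b ∧ 2 * y * v = u * (3 * x ^ 2 + a) ∧ v ^ 2 = 3 * x * u ^ 2 ∧
      u ^ 3 = -1 := by
  simp only [short, Pi.add_apply, Pi.smul_apply, smul_eq_mul, Matrix.cons_val] at h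
  refine ⟨?_, ?_, ?_, ?_⟩
  · linear_combination h 1 0
  · linear_combination (h 1 1 - h 1 (-1)) / 2 - h 0 1
  · linear_combination (h 1 1 + h 1 (-1)) / 2 - h 1 0
  · linear_combination - h 0 1

/-- The abscissas of the finite flexes are the roots of the division polynomial
`ψ₃ = 12 x f(x) - f'(x)²`, `f = x³ + a x + b`. It is separable, as its derivative is `12 f`. -/
theorem ncard_flex_abscissas {a b : ℂ} (h : 4 * a ^ 3 + 27 * b ^ 2 ≠ 0) :
    {x : ℂ | 12 * x * (x ^ 3 + a * x + b) = (3 * x ^ 2 + a) ^ 2}.ncard = 4 := by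
  set P : Polynomial ℂ := .C 3 * .X ^ 4 + .C (6 * a) * .X ^ 2 + .C (12 * b) * .X - .C (a ^ 2)
    with hP
  have hdeg : P.natDegree = 4 := by rw [hP]; compute_degree!
  have hP0 : P ≠ 0 := by rintro h0; rw [h0] at hdeg; simp at hdeg
  have hev : ∀ x, P.eval x = 12 * x * (x ^ 3 + a * x + b) - (3 * x ^ 2 + a) ^ 2 := by
    intro x; simp [hP]; ring
  have hder : ∀ x, P.derivative.eval x = 12 * (x ^ 3 + a * x + b) := by
    intro x
    simp only [hP, Polynomial.derivative_sub, Polynomial.derivative_add,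
      Polynomial.derivative_C_mul, Polynomial.derivative_X_pow, Polynomial.derivative_X,
      Polynomial.derivative_C, Polynomial.eval_sub, Polynomial.eval_add, Polynomial.eval_mul,
      Polynomial.eval_C, Polynomial.eval_pow, Polynomial.eval_X, Polynomial.eval_zero,
      Polynomial.eval_one]
    push_cast
    ring
  have hsep : P.Separable := by
    rw [Polynomial.Separable, Polynomial.isCoprime_iff_aeval_ne_zero_of_isAlgClosed ℂ ℂ]
    intro x
    by_contra hcon
    push Not at hcon
    obtain ⟨h1, h2⟩ := hcon
    rw [Polynomial.coe_aeval_eq_eval, hev] at h1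
    rw [Polynomial.coe_aeval_eq_eval, hder] at h2
    have hf : x ^ 3 + a * x + b = 0 := by simpa using h2
    have hf' : 3 * x ^ 2 + a = 0 := by
      rw [hf] at h1
      simpa using h1
    apply h
    have ha : a = -3 * x ^ 2 := by linear_combination hf'
    have hb : b = 2 * x ^ 3 := by linear_combination hf - x * hf'
    rw [ha, hb]; ring
  have hset : {x : ℂ | 12 * x * (x ^ 3 + a * x + b) = (3 * x ^ 2 + a) ^ 2} =
      P.roots.toFinset := by
    ext x
    simp only [Set.mem_ofPred_eq, Finset.mem_coe, Multiset.mem_toFinset, Polynomial.mem_roots hP0,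
      Polynomial.IsRoot.def, hev, sub_eq_zero]
  rw [hset, Set.ncard_coe_finset, Multiset.toFinset_card_of_nodup (Polynomial.nodup_roots hsep),
    IsAlgClosed.card_roots_eq_natDegree, hdeg]

theorem natCard_square_roots {c : ℂ} (hc : c ≠ 0) : Nat.card {y : ℂ // y ^ 2 = c} = 2 := by
  obtain ⟨s, hs⟩ := IsAlgClosed.exists_pow_nat_eq c (n := 2) two_pos
  have h : {y : ℂ | y ^ 2 = c} = {s, -s} := by
    ext y
    simp only [Set.mem_ofPred_eq, Set.mem_insert_iff, Set.mem_singleton_iff]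
    rw [← hs, sq_eq_sq_iff_eq_or_eq_neg]
  have hs0 : s ≠ 0 := by rintro rfl; exact hc (by rw [← hs]; norm_num)
  change Nat.card ({y : ℂ | y ^ 2 = c} : Set ℂ) = 2
  rw [h, Nat.card_coe_set_eq, Set.ncard_pair (fun h => hs0 (self_eq_neg.mp h))]

theorem flex_ordinate_ne_zero {a b : ℂ} (h : 4 * a ^ 3 + 27 * b ^ 2 ≠ 0) {x : ℂ}
    (hx : 12 * x * (x ^ 3 + a * x + b) = (3 * x ^ 2 + a) ^ 2) : x ^ 3 + a * x + b ≠ 0 := by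
  intro h0
  apply h
  have h1 : 3 * x ^ 2 + a = 0 := by
    rw [h0, mul_zero] at hx
    exact pow_eq_zero_iff two_ne_zero |>.mp hx.symm
  have ha : a = -3 * x ^ 2 := by linear_combination h1
  have hb : b = 2 * x ^ 3 := by linear_combination h0 - x * h1
  rw [ha, hb]; ring

theorem natCard_finite_flexes {a b : ℂ} (h : 4 * a ^ 3 + 27 * b ^ 2 ≠ 0) :
    Nat.card (Σ x : {x : ℂ | 12 * x * (x ^ 3 + a * x + b) = (3 * x ^ 2 + a) ^ 2},
      {y : ℂ // y ^ 2 = (x : ℂ) ^ 3 + a * x + b}) = 8 := by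
  have h4 := ncard_flex_abscissas h
  have : Finite {x : ℂ | 12 * x * (x ^ 3 + a * x + b) = (3 * x ^ 2 + a) ^ 2} :=
    Set.finite_of_ncard_ne_zero (by rw [h4]; norm_num)
  have h2 : ∀ x : {x : ℂ | 12 * x * (x ^ 3 + a * x + b) = (3 * x ^ 2 + a) ^ 2},
      Nat.card {y : ℂ // y ^ 2 = (x : ℂ) ^ 3 + a * x + b} = 2 :=
    fun x => natCard_square_roots (flex_ordinate_ne_zero h x.2)
  have : ∀ x : {x : ℂ | 12 * x * (x ^ 3 + a * x + b) = (3 * x ^ 2 + a) ^ 2},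
      Finite {y : ℂ // y ^ 2 = (x : ℂ) ^ 3 + a * x + b} :=
    fun x => Nat.finite_of_card_ne_zero (by rw [h2]; norm_num)
  have := Fintype.ofFinite {x : ℂ | 12 * x * (x ^ 3 + a * x + b) = (3 * x ^ 2 + a) ^ 2}
  rw [Nat.card_sigma]
  simp only [h2, Finset.sum_const, Finset.card_univ, ← Nat.card_eq_fintype_card,
    Nat.card_coe_set_eq, h4]
  norm_num

/-- A flex frame of `short a b` whose flex point is not at infinity. -/
theorem flexFrame_short_finite {a b : ℂ} (hab : 4 * a ^ 3 + 27 * b ^ 2 ≠ 0) {p q : E3}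
    (h : FlexFrame (short a b) p q) (hp : p 2 ≠ 0) :
    ∃ x y : ℂ, 12 * x * (x ^ 3 + a * x + b) = (3 * x ^ 2 + a) ^ 2 ∧
      y ^ 2 = x ^ 3 + a * x + b ∧ y ≠ 0 ∧ p = p 2 • ![x, y, 1] ∧
      ∃ c d : ℂ, q = c • ![x, y, 1] + d • ![-1, -(3 * x ^ 2 + a) / (2 * y), 0] := by
  have hP : p = p 2 • ![p 0 / p 2, p 1 / p 2, 1] := by
    ext i; fin_cases i <;> simp <;> field_simp
  generalize p 0 / p 2 = x at hP
  generalize p 1 / p 2 = y at hP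
  generalize p 2 = z at hP hp
  have hQ : q = q 2 • ![x, y, 1] + ![q 0 - q 2 * x, q 1 - q 2 * y, 0] := by
    ext i; fin_cases i <;> simp
  generalize q 0 - q 2 * x = u at hQ
  generalize q 1 - q 2 * y = v at hQ
  generalize q 2 = r at hQ
  obtain ⟨h1, h2, h3, h4⟩ := flex_equations (a := a) (b := b) (x := x) (y := y) (u := u) (v := v)
    (fun s t => by
      rw [← h.2 ((s - t * r) / z) t, hP, hQ, smul_smul, div_mul_cancel₀ _ hp]
      congr 1
      module)
  have hu : u ≠ 0 := by rintro rfl; norm_num at h4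
  have hx : 12 * x * (x ^ 3 + a * x + b) = (3 * x ^ 2 + a) ^ 2 := by
    refine mul_left_cancel₀ (pow_ne_zero 2 hu) ?_
    linear_combination (-4 * (x ^ 3 + a * x + b)) * h3 - 4 * v ^ 2 * h1 +
      (2 * y * v + u * (3 * x ^ 2 + a)) * h2
  have hy : y ≠ 0 := by
    rintro rfl
    exact flex_ordinate_ne_zero hab hx (by rw [← h1]; norm_num)
  refine ⟨x, y, hx, h1, hy, hP, r, -u, ?_⟩
  have hv : v = -u * (-(3 * x ^ 2 + a) / (2 * y)) := by
    field_simp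
    linear_combination h2
  rw [hQ, hv]
  congr 1
  ext i; fin_cases i <;> simp

theorem flexFrame_infty (a b : ℂ) : FlexFrame (short a b) infty ![-1, 0, 0] := by
  refine ⟨?_, fun s t => ?_⟩
  · rw [LinearIndependent.pair_iff]
    intro s t hst
    have h0 := congrFun hst 0
    have h1 := congrFun hst 1
    simp [infty] at h0 h1
    exact ⟨h1, h0⟩
  · simp only [short, infty, Pi.add_apply, Pi.smul_apply, smul_eq_mul, Matrix.cons_val]
    ring

theorem hasNineFlexes_short {a b : ℂ} (h : 4 * a ^ 3 + 27 * b ^ 2 ≠ 0) :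
    HasNineFlexes (short a b) := by
  let T := Σ x : {x : ℂ | 12 * x * (x ^ 3 + a * x + b) = (3 * x ^ 2 + a) ^ 2},
      {y : ℂ // y ^ 2 = (x : ℂ) ^ 3 + a * x + b}
  have hT : Nat.card T = 8 := natCard_finite_flexes h
  have hfin : Finite T := Nat.finite_of_card_ne_zero (by rw [hT]; norm_num)
  let p : Option T → E3 := fun i => i.elim infty fun P => ![P.1, P.2, 1]
  let q : Option T → E3 := fun i => i.elim ![-1, 0, 0] fun P =>
    ![-1, -(3 * (P.1 : ℂ) ^ 2 + a) / (2 * P.2), 0]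
  refine ⟨Option T, p, q, by rw [Finite.card_option, hT], ?_, ?_, ?_⟩
  · rintro (_ | ⟨⟨x, hx⟩, y, hy⟩)
    · exact flexFrame_infty a b
    · have hf := flex_ordinate_ne_zero h hx
      simp only at hy
      have hy0 : y ≠ 0 := by rintro rfl; exact hf (by rw [← hy]; norm_num)
      change FlexFrame _ ![x, y, 1] ![-1, -(3 * x ^ 2 + a) / (2 * y), 0]
      refine ⟨?_, fun s t => ?_⟩
      · rw [LinearIndependent.pair_iff]
        intro s t hst
        have h0 := congrFun hst 0
        have h2 := congrFun hst 2
        simp at h0 h2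
        rw [h2] at h0
        exact ⟨h2, by simpa using h0⟩
      · have hw : 4 * y ^ 2 * (-(3 * x ^ 2 + a) / (2 * y)) ^ 2 = 4 * y ^ 2 * (3 * x) := by
          rw [Set.mem_ofPred_eq] at hx
          field_simp
          rw [hy]
          linear_combination -hx
        have hw' := mul_left_cancel₀ (mul_ne_zero (by norm_num) (pow_ne_zero 2 hy0)) hw
        have hw1 : 2 * y * (-(3 * x ^ 2 + a) / (2 * y)) = -(3 * x ^ 2 + a) := by field_simp
        generalize -(3 * x ^ 2 + a) / (2 * y) = w at hw' hw1
        simp only [short, Pi.add_apply, Pi.smul_apply, smul_eq_mul, Matrix.cons_val]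
        linear_combination s ^ 3 * hy + s ^ 2 * t * hw1 + s * t ^ 2 * hw'
  · rintro (_ | ⟨⟨x, hx⟩, y, hy⟩) (_ | ⟨⟨x', hx'⟩, y', hy'⟩) c hc
    · rfl
    · have h2 : infty 2 = (c • ![x', y', 1] : E3) 2 := congrFun hc 2
      have h1 : infty 1 = (c • ![x', y', 1] : E3) 1 := congrFun hc 1
      simp [infty] at h1 h2
      simp [← h2] at h1
    · have h2 : (![x, y, 1] : E3) 2 = (c • infty) 2 := congrFun hc 2
      simp [infty] at h2
    · have h0 : (![x, y, 1] : E3) 0 = (c • ![x', y', 1] : E3) 0 := congrFun hc 0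
      have h1 : (![x, y, 1] : E3) 1 = (c • ![x', y', 1] : E3) 1 := congrFun hc 1
      have h2 : (![x, y, 1] : E3) 2 = (c • ![x', y', 1] : E3) 2 := congrFun hc 2
      simp at h0 h1 h2
      rw [← h2, one_mul] at h0 h1
      subst h0 h1
      rfl
  · intro p' q' hpq
    by_cases hz : p' 2 = 0
    · have hev := hpq.2
      simp only [short, Pi.add_apply, Pi.smul_apply, smul_eq_mul, hz] at hev
      have hp0 : p' 0 = 0 := by
        have := hev 1 0
        simpa using this
      have hp1 : p' 1 ≠ 0 := by
        intro h1
        refine hpq.1.ne_zero 0 ?_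
        ext i; fin_cases i
        · exact hp0
        · exact h1
        · exact hz
      have hq2 : p' 1 ^ 2 * q' 2 = 0 := by
        rw [hp0] at hev
        linear_combination (hev 1 1 + hev (-1) 1 - 2 * hev 0 1) / 2
      have hq2' : q' 2 = 0 := (mul_eq_zero.mp hq2).resolve_left (pow_ne_zero 2 hp1)
      refine ⟨none, ⟨p' 1, ?_⟩, q' 1, -q' 0, ?_⟩
      · change p' = p' 1 • infty
        ext i; fin_cases i <;> simp [infty, hp0, hz]
      · change q' = q' 1 • infty + -q' 0 • ![-1, 0, 0]
        ext i; fin_cases i <;> simp [infty, hq2']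
    · obtain ⟨x, y, hx, hy, -, hp, hq⟩ := flexFrame_short_finite h hpq hz
      exact ⟨some ⟨⟨x, hx⟩, y, hy⟩, ⟨_, hp⟩, hq⟩

/-- The nine flexes of a smooth cubic that has a flex. -/
theorem SmoothCubic.hasNineFlexes {F : E3 → ℂ} (hF : SmoothCubic F) {p q : E3}
    (h : FlexFrame F p q) : HasNineFlexes F := by
  obtain ⟨a, b, hab, e, he, -⟩ := hF.exists_short h
  exact (hasNineFlexes_short hab).of_isos he

/-! ### The automorphism group acts transitively on the flexes -/

/-- The involution `y ↦ -y`. -/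
def negY : E3 ≃ₗ[ℂ] E3 :=
  LinearEquiv.ofInvolutive
    { toFun := fun x => ![x 0, -x 1, x 2]
      map_add' := fun x y => by ext i; fin_cases i <;> simp [add_comm]
      map_smul' := fun c x => by ext i; fin_cases i <;> simp }
    (fun x => by ext i; fin_cases i <;> simp)

theorem negY_apply (x : E3) : negY x = ![x 0, -x 1, x 2] := rfl

theorem negY_mem_isos (a b : ℂ) : negY ∈ Isos (short a b) (short a b) := fun x => by
  simp [negY_apply, short]

/-- Any flex can be moved to any other by a linear automorphism of the form `F`: if `r` is the
third point of the curve on the line through the flexes `p` and `p'`, then `r` is a flex too, and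
the involution `y ↦ -y` of a short Weierstrass form with `r` at infinity exchanges `p` and `p'`. -/
theorem SmoothCubic.exists_isos_map_flex {F : E3 → ℂ} (hF : SmoothCubic F) {p q p' q' : E3}
    (h : FlexFrame F p q) (h' : FlexFrame F p' q') :
    ∃ e ∈ Isos F F, ∃ c : ℂ, e p = c • p' := by
  by_cases hpp : ∃ c : ℂ, p = c • p'
  · exact ⟨LinearEquiv.refl ℂ E3, fun x => rfl, hpp⟩
  obtain ⟨a, b, hab, e, he, k, hk, hep⟩ := hF.exists_short h
  have h1 := flexFrame_of_isos he h'
  have h12 : (e p') 2 ≠ 0 := by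
    intro hz
    have hev := h1.2 1 0
    have h0 : (e p') 0 = 0 := by simpa [short, hz] using hev
    have h11 : (e p') 1 ≠ 0 := by
      intro h11
      refine h1.1.ne_zero 0 ?_
      ext i; fin_cases i
      · exact h0
      · exact h11
      · exact hz
    refine hpp ⟨k / (e p') 1, e.injective ?_⟩
    rw [map_smul, hep]
    ext i; fin_cases i <;> simp [infty, h0, hz, h11]
  obtain ⟨x, y, -, -, hy, hep', -⟩ := flexFrame_short_finite hab h1 h12
  generalize (e p') 2 = z at h12 hep'
  -- `e.symm (negY (e p'))` is the third point on the line through `p` and `p'`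
  have hr : FlexFrame F (e.symm (negY (e p'))) (e.symm (negY (e q'))) :=
    flexFrame_of_isos (isos_symm he) (flexFrame_of_isos (negY_mem_isos a b) h1)
  have hrel : e.symm (negY (e p')) = p' - (2 * y * z / k) • p := by
    rw [LinearEquiv.symm_apply_eq, map_sub, map_smul, hep, hep', negY_apply]
    ext i; fin_cases i <;> simp [infty]
    field_simp
    ring
  rw [hrel] at hr
  have hα : 2 * y * z / k ≠ 0 := div_ne_zero (mul_ne_zero (mul_ne_zero two_ne_zero hy) h12) hk
  generalize 2 * y * z / k = α at hr hα
  obtain ⟨a', b', -, f, hf, l, hl, hfr⟩ := hF.exists_short hr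
  have hp0 : short a' b' (f p) = 0 := by rw [hf]; simpa using h.2 1 0
  have hp0' : short a' b' (f p') = 0 := by rw [hf]; simpa using h'.2 1 0
  rw [map_sub, map_smul] at hfr
  have e0 := congrFun hfr 0
  have e1 := congrFun hfr 1
  have e2 := congrFun hfr 2
  simp [infty] at e0 e1 e2
  have hz1 : (f p) 2 ≠ 0 := by
    intro hz
    have hx : (f p) 0 = 0 := by simpa [short, hz] using hp0
    rw [hz, mul_zero, sub_zero] at e2
    rw [hx, mul_zero, sub_zero] at e0
    have hp' : (f p') 1 ≠ 0 := by
      intro h1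
      refine (flexFrame_of_isos hf h').1.ne_zero 0 ?_
      ext i; fin_cases i
      · exact e0
      · exact h1
      · exact e2
    refine hpp ⟨(f p) 1 / (f p') 1, f.injective ?_⟩
    rw [map_smul]
    ext i; fin_cases i <;> simp [hx, hz, e0, e2, hp']
  simp only [short] at hp0 hp0'
  rw [sub_eq_zero.mp e0, sub_eq_zero.mp e2] at hp0'
  have hsq : (α * (f p) 2) * (((f p') 1 - α * (f p) 1) * ((f p') 1 + α * (f p) 1)) = 0 := by
    linear_combination hp0' - α ^ 3 * hp0
  rw [e1] at hsq
  have hneg : (f p') 1 + α * (f p) 1 = 0 := by simpa [hα, hz1, hl] using hsq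
  refine ⟨(f.trans negY).trans f.symm, isos_trans (isos_trans hf (negY_mem_isos a' b'))
    (isos_symm hf), α⁻¹, ?_⟩
  rw [LinearEquiv.trans_apply, LinearEquiv.trans_apply, LinearEquiv.symm_apply_eq, map_smul,
    negY_apply]
  ext i; fin_cases i
  · simp [sub_eq_zero.mp e0, hα]
  · simp [eq_neg_of_add_eq_zero_left hneg, hα]
  · simp [sub_eq_zero.mp e2, hα]

/-! ### Counting automorphisms of a smooth cubic form -/

/-- Orbit counting for the action on the nine flexes. -/
theorem SmoothCubic.natCard_isos_self {F : E3 → ℂ} (hF : SmoothCubic F) {p q : E3}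
    (h : FlexFrame F p q) :
    Nat.card (Isos F F) = 9 * Nat.card {e : E3 ≃ₗ[ℂ] E3 // e ∈ Isos F F ∧ ∃ c : ℂ, e p = c • p} := by
  obtain ⟨ι, p', q', hι, h1, h2, h3⟩ := hF.hasNineFlexes h
  choose t ht c hc using fun i => hF.exists_isos_map_flex h (h1 i)
  have hc0 : ∀ i, c i ≠ 0 := by
    intro i hi
    have := hc i
    rw [hi, zero_smul, LinearEquiv.map_eq_zero_iff] at this
    exact h.1.ne_zero 0 this
  rw [← hι, ← Nat.card_prod]
  refine (Nat.card_congr (Equiv.ofBijective (fun x : ι × {e : E3 ≃ₗ[ℂ] E3 // e ∈ Isos F F ∧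
    ∃ c : ℂ, e p = c • p} => (⟨x.2.1.trans (t x.1), isos_trans x.2.2.1 (ht x.1)⟩ : Isos F F))
    ⟨?_, ?_⟩)).symm
  · rintro ⟨i, s, hs, d, hd⟩ ⟨j, s', hs', d', hd'⟩ heq
    have heq' : s.trans (t i) = s'.trans (t j) := congrArg Subtype.val heq
    have hp := LinearEquiv.congr_fun heq' p
    simp only [LinearEquiv.trans_apply, hd, hd', map_smul, hc, smul_smul] at hp
    have hd0 : d ≠ 0 := by
      rintro rfl
      rw [zero_smul, LinearEquiv.map_eq_zero_iff] at hd
      exact h.1.ne_zero 0 hd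
    obtain rfl : i = j := by
      refine h2 i j ((d * c i)⁻¹ * (d' * c j)) ?_
      rw [mul_smul, ← hp, smul_smul, inv_mul_cancel₀ (mul_ne_zero hd0 (hc0 i)), one_smul]
    obtain rfl : s = s' := by
      ext1 x
      exact (t i).injective (LinearEquiv.congr_fun heq' x)
    rfl
  · rintro ⟨g, hg⟩
    obtain ⟨i, ⟨d, hd⟩, -⟩ := h3 _ _ (flexFrame_of_isos hg h)
    refine ⟨⟨i, g.trans (t i).symm, isos_trans hg (isos_symm (ht i)), d * (c i)⁻¹, ?_⟩, ?_⟩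
    · rw [LinearEquiv.trans_apply, hd, LinearEquiv.symm_apply_eq, map_smul, hc, smul_smul,
        inv_mul_cancel_right₀ (hc0 i)]
    · apply Subtype.ext
      ext1 x
      simp

theorem infty_zero : infty 0 = 0 := rfl

theorem infty_one : infty 1 = 1 := rfl

theorem infty_two : infty 2 = 0 := rfl

/-- The linear automorphisms of `short a b` fixing the point at infinity are diagonal. -/
theorem diagonal_of_fixes_infty {a b : ℂ} {e : E3 ≃ₗ[ℂ] E3} (he : e ∈ Isos (short a b) (short a b))
    {c : ℂ} (hc : e infty = c • infty) : ∃ α γ : ℂ, (∀ x, e x = ![α * x 0, c * x 1, γ * x 2]) ∧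
      c ^ 2 * γ = 1 ∧ α ^ 3 = 1 ∧ a * α * γ ^ 2 = a ∧ b * γ ^ 3 = b := by
  have hex : ∀ x : E3, e x = x 0 • e ![1, 0, 0] + (c * x 1) • infty + x 2 • e ![0, 0, 1] := by
    intro x
    have : x = x 0 • ![1, 0, 0] + x 1 • infty + x 2 • ![0, 0, 1] := by
      ext i; fin_cases i <;> simp [infty]
    conv_lhs => rw [this]
    rw [map_add, map_add, map_smul, map_smul, map_smul, hc, smul_smul, mul_comm c]
  have hc0 : c ≠ 0 := by
    rintro rfl
    rw [zero_smul, LinearEquiv.map_eq_zero_iff] at hc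
    simpa [infty] using congrFun hc 1
  generalize e ![1, 0, 0] = A at hex
  generalize e ![0, 0, 1] = D at hex
  have key : ∀ x y z : ℂ, short a b ![x * A 0 + z * D 0, x * A 1 + c * y + z * D 1,
      x * A 2 + z * D 2] = short a b ![x, y, z] := by
    intro x y z
    rw [← he ![x, y, z], hex]
    congr 1
    ext i; fin_cases i <;> simp [infty_zero, infty_one, infty_two]
  simp only [short, Matrix.cons_val] at key
  have hA2 : A 2 = 0 := by
    have : c ^ 2 * A 2 = 0 := by
      linear_combination (key 1 1 0 + key 1 (-1) 0 - 2 * key 1 0 0) / 2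
    simpa [hc0] using this
  simp only [hA2, mul_zero, zero_add] at key
  have hγ : c ^ 2 * D 2 = 1 := by
    linear_combination (key 0 1 1 + key 0 (-1) 1 - 2 * key 0 0 1) / 2
  have hD2 : D 2 ≠ 0 := by intro h; rw [h] at hγ; norm_num at hγ
  have hD1 : D 1 = 0 := by
    have : c * D 2 * D 1 = 0 := by linear_combination (key 0 1 1 - key 0 (-1) 1) / 4
    simpa [hc0, hD2] using this
  have hA1 : A 1 = 0 := by
    have : c * D 2 * A 1 = 0 := by
      linear_combination (key 1 1 1 - key 1 (-1) 1) / 4 - c * D 2 * hD1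
    simpa [hc0, hD2] using this
  simp only [hA1, hD1, mul_zero, add_zero, zero_add] at key
  have hα : A 0 ^ 3 = 1 := by linear_combination - key 1 0 0
  have hA0 : A 0 ≠ 0 := by intro h; rw [h] at hα; norm_num at hα
  have hD0 : D 0 = 0 := by
    have : A 0 ^ 2 * D 0 = 0 := by
      linear_combination (key 1 0 1 + key (-1) 0 1 - 2 * key 0 0 1) / (-6)
    simpa [hA0] using this
  simp only [hD0, mul_zero, add_zero] at key
  refine ⟨A 0, D 2, fun x => ?_, hγ, hα, ?_, ?_⟩
  · rw [hex]
    ext i; fin_cases i <;>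
      simp [infty_zero, infty_one, infty_two, hA1, hA2, hD0, hD1, mul_comm]
  · linear_combination (key (-1) 0 1 - key 0 0 1) - hα
  · linear_combination - key 0 0 1

/-- The stabilizer of the point at infinity, `(x, y, z) ↦ (α x, δ y, δ⁻² z)`, parametrized
by `(α, δ)`. -/
theorem natCard_stabilizer_infty (a b : ℂ) :
    Nat.card {e : E3 ≃ₗ[ℂ] E3 // e ∈ Isos (short a b) (short a b) ∧
      ∃ c : ℂ, e infty = c • infty} =
    Nat.card {x : ℂ × ℂ // x.1 ^ 3 = 1 ∧ x.2 ≠ 0 ∧ a * x.1 = a * x.2 ^ 4 ∧ b = b * x.2 ^ 6} := by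
  let D : ℂ × ℂ → (E3 →ₗ[ℂ] E3) := fun x =>
    { toFun := fun v => ![x.1 * v 0, x.2 * v 1, (x.2 ^ 2)⁻¹ * v 2]
      map_add' := fun u v => by ext i; fin_cases i <;> simp [mul_add]
      map_smul' := fun c v => by ext i; fin_cases i <;> simp [mul_left_comm] }
  have hD : ∀ x v, D x v = ![x.1 * v 0, x.2 * v 1, (x.2 ^ 2)⁻¹ * v 2] := fun x v => rfl
  have hinj : ∀ x : ℂ × ℂ, x.1 ^ 3 = 1 → x.2 ≠ 0 → Function.Injective (D x) := by
    intro x h1 h2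
    have h1' : x.1 ≠ 0 := by intro h; rw [h] at h1; norm_num at h1
    rw [← LinearMap.ker_eq_bot, LinearMap.ker_eq_bot']
    intro v hv
    rw [hD] at hv
    have e0 := congrFun hv 0
    have e1 := congrFun hv 1
    have e2 := congrFun hv 2
    simp [h1', h2] at e0 e1 e2
    ext i; fin_cases i
    · exact e0
    · exact e1
    · exact e2
  symm
  refine Nat.card_congr (Equiv.ofBijective (fun x => ⟨LinearEquiv.ofInjectiveEndo (D x.1)
    (hinj x.1 x.2.1 x.2.2.1), fun v => ?_, x.1.2, ?_⟩) ⟨?_, ?_⟩)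
  · obtain ⟨⟨α, δ⟩, h1, h2, h3, h4⟩ := x
    rw [LinearEquiv.coe_ofInjectiveEndo, hD]
    simp only at h1 h2 h3 h4
    simp only [short, Matrix.cons_val]
    field_simp
    linear_combination (-v 0 ^ 3 * δ ^ 6) * h1 - (δ ^ 2 * v 0 * v 2 ^ 2) * h3 - v 2 ^ 3 * h4
  · rw [LinearEquiv.coe_ofInjectiveEndo, hD]
    ext i; fin_cases i <;> simp [infty]
  · rintro ⟨⟨α, δ⟩, h⟩ ⟨⟨α', δ'⟩, h'⟩ heq
    have heq' := fun v => LinearEquiv.congr_fun (congrArg Subtype.val heq) v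
    simp only [LinearEquiv.coe_ofInjectiveEndo, hD] at heq'
    have e0 := congrFun (heq' ![1, 1, 1]) 0
    have e1 := congrFun (heq' ![1, 1, 1]) 1
    simp at e0 e1
    subst e0 e1
    rfl
  · rintro ⟨e, he, c, hc⟩
    obtain ⟨α, γ, hdiag, h1, h2, h3, h4⟩ := diagonal_of_fixes_infty he hc
    have hc0 : c ≠ 0 := by rintro rfl; norm_num at h1
    have hγ : γ = (c ^ 2)⁻¹ := by field_simp; linear_combination h1
    subst hγ
    refine ⟨⟨(α, c), h2, hc0, ?_, ?_⟩, ?_⟩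
    · simp only
      field_simp at h3
      linear_combination h3
    · simp only
      field_simp at h4
      linear_combination h4
    · apply Subtype.ext
      ext1 v
      change D (α, c) v = e v
      rw [hD, hdiag]

theorem natCard_pow_eq_one {n : ℕ} (hn : n ≠ 0) : Nat.card {z : ℂ // z ^ n = 1} = n := by
  have : NeZero n := ⟨hn⟩
  have h := (Complex.isPrimitiveRoot_exp n hn).card_nthRootsFinset
  rw [← Set.ncard_coe_finset] at h
  change Nat.card ({z : ℂ | z ^ n = 1} : Set ℂ) = n
  rw [Nat.card_coe_set_eq]
  convert h using 2
  ext z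
  simp [Polynomial.mem_nthRootsFinset (Nat.pos_of_ne_zero hn)]

/-- The number of linear automorphisms of `short a b`: nine times the order of the stabilizer of a
flex, which is `18`, `12` or `6` according as `a = 0`, `b = 0` or neither. -/
theorem natCard_isos_short {a b : ℂ} (h : 4 * a ^ 3 + 27 * b ^ 2 ≠ 0)
    (hs : SmoothCubic (short a b)) :
    (a = 0 → Nat.card (Isos (short a b) (short a b)) = 162) ∧
    (b = 0 → Nat.card (Isos (short a b) (short a b)) = 108) ∧
    (a ≠ 0 → b ≠ 0 → Nat.card (Isos (short a b) (short a b)) = 54) := by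
  rw [hs.natCard_isos_self (flexFrame_infty a b), natCard_stabilizer_infty]
  refine ⟨fun ha => ?_, fun hb => ?_, fun ha hb => ?_⟩
  · have hb : b ≠ 0 := by rintro rfl; simp [ha] at h
    have e : {x : ℂ × ℂ // x.1 ^ 3 = 1 ∧ x.2 ≠ 0 ∧ a * x.1 = a * x.2 ^ 4 ∧ b = b * x.2 ^ 6} ≃
        {z : ℂ // z ^ 3 = 1} × {z : ℂ // z ^ 6 = 1} :=
      { toFun := fun x => (⟨x.1.1, x.2.1⟩, ⟨x.1.2, by
          have := x.2.2.2.2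
          rwa [left_eq_mul₀ hb] at this⟩)
        invFun := fun z => ⟨(z.1.1, z.2.1), z.1.2, fun h0 => by
            have h1 := z.2.2
            simp only at h0
            rw [h0] at h1
            norm_num at h1,
          by simp [ha], by simp [z.2.2]⟩
        left_inv := fun x => rfl
        right_inv := fun x => rfl }
    rw [Nat.card_congr e, Nat.card_prod, natCard_pow_eq_one (by norm_num),
      natCard_pow_eq_one (by norm_num)]
  · have ha : a ≠ 0 := by rintro rfl; simp [hb] at h
    have e : {x : ℂ × ℂ // x.1 ^ 3 = 1 ∧ x.2 ≠ 0 ∧ a * x.1 = a * x.2 ^ 4 ∧ b = b * x.2 ^ 6} ≃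
        {z : ℂ // z ^ 12 = 1} :=
      { toFun := fun x => ⟨x.1.2, by
          have h1 := x.2.1
          rw [mul_left_cancel₀ ha x.2.2.2.1] at h1
          linear_combination h1⟩
        invFun := fun z => ⟨(z.1 ^ 4, z.1), by simp only; linear_combination z.2,
          fun h0 => by
            have h1 := z.2
            simp only at h0
            rw [h0] at h1
            norm_num at h1, rfl, by simp [hb]⟩
        left_inv := fun x => Subtype.ext (Prod.ext (mul_left_cancel₀ ha x.2.2.2.1).symm rfl)
        right_inv := fun x => rfl }
    rw [Nat.card_congr e, natCard_pow_eq_one (by norm_num)]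
  · have e : {x : ℂ × ℂ // x.1 ^ 3 = 1 ∧ x.2 ≠ 0 ∧ a * x.1 = a * x.2 ^ 4 ∧ b = b * x.2 ^ 6} ≃
        {z : ℂ // z ^ 6 = 1} :=
      { toFun := fun x => ⟨x.1.2, by
          have := x.2.2.2.2
          rwa [left_eq_mul₀ hb] at this⟩
        invFun := fun z => ⟨(z.1 ^ 4, z.1), by
            simp only
            rw [show (z.1 ^ 4) ^ 3 = (z.1 ^ 6) ^ 2 by ring, z.2, one_pow],
          fun h0 => by
            have h1 := z.2
            simp only at h0
            rw [h0] at h1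
            norm_num at h1, rfl, by simp [z.2]⟩
        left_inv := fun x => Subtype.ext (Prod.ext (mul_left_cancel₀ ha x.2.2.2.1).symm rfl)
        right_inv := fun x => rfl }
    rw [Nat.card_congr e, natCard_pow_eq_one (by norm_num)]

/-! ### Classification of the planes -/

theorem SmoothCubic.map_smul {F : E3 → ℂ} (hF : SmoothCubic F) (t : ℂ) (x : E3) :
    F (t • x) = t ^ 3 * F x := by
  obtain ⟨B, hB, -⟩ := hF
  rw [hB.diag, hB.diag]
  simp only [LinearMap.map_smul, LinearMap.smul_apply, smul_eq_mul]
  ring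

theorem SmoothCubic.map_zero {F : E3 → ℂ} (hF : SmoothCubic F) : F 0 = 0 := by
  simpa using hF.map_smul 0 0

/-- The three-dimensional subspaces of `ℂ³ × ℂ³` on which `F x = G y`. -/
def planeSet (F G : E3 → ℂ) : Set (Submodule ℂ (E3 × E3)) :=
  {V | Module.finrank ℂ V = 3 ∧ ∀ v ∈ V, F v.1 = G v.2}

/-- The subspace spanned by `(p, 0)`, `(0, p')` and `(q, q')`. If `(p, q)` and `(p', q')` are flex
frames, it is the join of two flex points and a point over the product of the tangent lines. -/
def flexPlane (p q p' q' : E3) : Submodule ℂ (E3 × E3) :=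
  Submodule.span ℂ (Set.range ![(p, 0), (0, p'), (q, q')])

theorem mem_flexPlane {p q p' q' : E3} {v : E3 × E3} : v ∈ flexPlane p q p' q' ↔
    ∃ a b c : ℂ, v.1 = a • p + c • q ∧ v.2 = b • p' + c • q' := by
  rw [flexPlane, Submodule.mem_span_range_iff_exists_fun]
  constructor
  · rintro ⟨c, rfl⟩
    exact ⟨c 0, c 1, c 2, by simp [Fin.sum_univ_three], by simp [Fin.sum_univ_three]⟩
  · rintro ⟨a, b, c, h1, h2⟩
    exact ⟨![a, b, c], Prod.ext (by simp [Fin.sum_univ_three, h1])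
      (by simp [Fin.sum_univ_three, h2])⟩

theorem flexPlane_mem_planeSet {F G : E3 → ℂ} {p q p' q' : E3} (h : FlexFrame F p q)
    (h' : FlexFrame G p' q') : flexPlane p q p' q' ∈ planeSet F G := by
  refine ⟨?_, fun v hv => ?_⟩
  · have hind : LinearIndependent ℂ ![((p, 0) : E3 × E3), (0, p'), (q, q')] := by
      rw [Fintype.linearIndependent_iff]
      intro g hg
      simp only [Fin.sum_univ_three, Matrix.cons_val] at hg
      have h1 := congrArg Prod.fst hg
      have h2 := congrArg Prod.snd hg
      simp at h1 h2
      obtain ⟨g0, g2⟩ := LinearIndependent.pair_iff.mp h.1 _ _ h1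
      obtain ⟨g1, -⟩ := LinearIndependent.pair_iff.mp h'.1 _ _ h2
      intro i
      fin_cases i
      · exact g0
      · exact g1
      · exact g2
    rw [flexPlane, finrank_span_eq_card hind, Fintype.card_fin]
  · obtain ⟨a, b, c, h1, h2⟩ := mem_flexPlane.mp hv
    rw [h1, h2, h.2, h'.2]

section

variable {W : Type*} [AddCommGroup W] [Module ℂ W] {F G : E3 → ℂ} {f g : W →ₗ[ℂ] E3}

/-- If the plane embedded by `(f, g) : W → ℂ³ × ℂ³` meets `0 × ℂ³`, it also meets `ℂ³ × 0`: otherwise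
it surjects onto the second factor, and its point in `0 × ℂ³` is singular on `G = 0`. -/
theorem exists_in_left_factor (hF : SmoothCubic F) (hG : SmoothCubic G)
    (hW : Module.finrank ℂ W = 3) (hFG : ∀ w, F (f w) = G (g w))
    (h0 : ∀ w, f w = 0 → g w = 0 → w = 0) (h : ∃ w, f w = 0 ∧ g w ≠ 0) : ∃ w, f w ≠ 0 ∧ g w = 0 := by
  obtain ⟨w, hfw, hgw⟩ := h
  by_contra hcon
  push Not at hcon
  have hinj : Function.Injective g := by
    rw [← LinearMap.ker_eq_bot, LinearMap.ker_eq_bot']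
    intro x hgx
    by_contra hx
    exact hcon x (fun hfx => hx (h0 x hfx hgx)) hgx
  have : FiniteDimensional ℂ W := Module.finite_of_finrank_eq_succ hW
  have hsurj : Function.Surjective g :=
    (LinearMap.injective_iff_surjective_of_finrank_eq_finrank (by simp [hW])).mp hinj
  refine hgw (hG.eq_zero_of_isSingularAt fun u => ?_)
  obtain ⟨x, rfl⟩ := hsurj u
  refine ⟨0, F (f x), fun t => ?_⟩
  rw [← LinearMap.map_smul, ← map_add, ← hFG, map_add, hfw, zero_add, LinearMap.map_smul,
    hF.map_smul]
  ring

/-- Over a plane meeting both factors, the point in the left factor and a further point of the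
plane project to independent vectors; otherwise `G = 0` would contain a line. -/
theorem linearIndependent_left (hF : SmoothCubic F) (hG : SmoothCubic G)
    (hFG : ∀ w, F (f w) = G (g w)) (h0 : ∀ w, f w = 0 → g w = 0 → w = 0) {a b v : W}
    (hfa : f a ≠ 0) (hfb : f b = 0) (hgb : g b ≠ 0)
    (hv : ∀ s t : ℂ, v ≠ s • a + t • b) : LinearIndependent ℂ ![f a, f v] := by
  rw [LinearIndependent.pair_iff' hfa]
  intro r hr
  have hfw : f (v - r • a) = 0 := by rw [map_sub, LinearMap.map_smul, hr, sub_self]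
  refine hG.not_line (p := g b) (q := g (v - r • a)) ?_ fun s t => ?_
  · rw [LinearIndependent.pair_iff' hgb]
    intro s hs
    have := h0 (v - r • a - s • b)
      (by rw [map_sub, LinearMap.map_smul, hfw, hfb, smul_zero, sub_zero])
      (by rw [map_sub, LinearMap.map_smul, hs, sub_self])
    refine hv r s ?_
    rw [← sub_eq_zero, ← this]
    abel
  · rw [← LinearMap.map_smul, ← LinearMap.map_smul, ← map_add, ← hFG, map_add,
      LinearMap.map_smul, LinearMap.map_smul, hfw, hfb, smul_zero, smul_zero, add_zero, hF.map_zero]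

end

/-- A plane in `F x = G y` is the graph of an isomorphism of `F` with `G` if it meets neither
factor, and otherwise it is given by a pair of flexes. -/
theorem mem_planeSet_cases {F G : E3 → ℂ} (hF : SmoothCubic F) (hG : SmoothCubic G)
    {V : Submodule ℂ (E3 × E3)} (hV : V ∈ planeSet F G) :
    (∃ e ∈ Isos F G, V = (e : E3 →ₗ[ℂ] E3).graph) ∨
      ∃ p q p' q', FlexFrame F p q ∧ FlexFrame G p' q' ∧ V = flexPlane p q p' q' := by
  obtain ⟨hdim, hVFG⟩ := hV
  let f : V →ₗ[ℂ] E3 := (LinearMap.fst ℂ E3 E3).comp V.subtype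
  let g : V →ₗ[ℂ] E3 := (LinearMap.snd ℂ E3 E3).comp V.subtype
  have hFG : ∀ w, F (f w) = G (g w) := fun w => hVFG w w.2
  have h0 : ∀ w, f w = 0 → g w = 0 → w = 0 := fun w h1 h2 => Subtype.ext (Prod.ext h1 h2)
  by_cases hex : ∃ w, f w = 0 ∧ g w ≠ 0
  · right
    obtain ⟨b, hfb, hgb⟩ := id hex
    obtain ⟨a, hfa, hga⟩ := exists_in_left_factor hF hG hdim hFG h0 hex
    have hlt : Submodule.span ℂ (Set.range ![a, b]) < ⊤ := by
      rw [lt_top_iff_ne_top]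
      intro htop
      have h1 := finrank_range_le_card (R := ℂ) ![a, b]
      rw [Set.finrank, htop, finrank_top, hdim] at h1
      simp at h1
    obtain ⟨v, -, hv⟩ := SetLike.exists_of_lt hlt
    have hv' : ∀ s t : ℂ, v ≠ s • a + t • b := by
      rintro s t rfl
      refine hv ((Submodule.mem_span_range_iff_exists_fun ℂ).mpr ⟨![s, t], ?_⟩)
      simp [Fin.sum_univ_two]
    have i1 := linearIndependent_left hF hG hFG h0 hfa hfb hgb hv'
    have i2 := linearIndependent_left hG hF (fun w => (hFG w).symm) (fun w h1 h2 => h0 w h2 h1)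
      hgb hga hfa (fun s t => by rw [add_comm]; exact hv' t s)
    have e1 : ∀ s t : ℂ, F (s • f a + t • f v) = t ^ 3 * F (f v) := by
      intro s t
      rw [hFG v, ← hG.map_smul, ← LinearMap.map_smul, ← LinearMap.map_smul, ← map_add, hFG,
        map_add, LinearMap.map_smul, hga, smul_zero, zero_add, LinearMap.map_smul]
    have e2 : ∀ s t : ℂ, G (s • g b + t • g v) = t ^ 3 * F (f v) := by
      intro s t
      rw [← hF.map_smul, ← LinearMap.map_smul, ← LinearMap.map_smul, ← map_add, ← hFG,
        map_add, LinearMap.map_smul, hfb, smul_zero, zero_add, LinearMap.map_smul]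
    have hFv : F (f v) ≠ 0 := fun h => hF.not_line i1 fun s t => by rw [e1, h, mul_zero]
    obtain ⟨k, hk⟩ := IsAlgClosed.exists_pow_nat_eq (F (f v)) (n := 3) (by norm_num)
    have hk0 : k ≠ 0 := by rintro rfl; exact hFv (by rw [← hk]; norm_num)
    rw [← hk] at e1 e2
    have hframe : ∀ {H : E3 → ℂ} {p q : E3}, LinearIndependent ℂ ![p, q] →
        (∀ s t : ℂ, H (s • p + t • q) = t ^ 3 * k ^ 3) → FlexFrame H p (k⁻¹ • q) := by
      intro H p q hi he
      refine ⟨?_, fun s t => ?_⟩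
      · rw [LinearIndependent.pair_iff] at hi ⊢
        intro s t hst
        rw [smul_smul] at hst
        simpa [hk0] using hi _ _ hst
      · rw [smul_smul, he]
        field_simp
    have f1 := hframe i1 e1
    have f2 := hframe i2 e2
    refine ⟨_, _, _, _, f1, f2, (Submodule.eq_of_le_of_finrank_eq ?_ ?_).symm⟩
    · rw [flexPlane, Submodule.span_le]
      rintro - ⟨i, rfl⟩
      fin_cases i
      · have : ((f a, 0) : E3 × E3) = a := Prod.ext rfl hga.symm
        simp only [Fin.zero_eta, Matrix.cons_val_zero, this]
        exact a.2
      · have : ((0, g b) : E3 × E3) = b := Prod.ext hfb.symm rfl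
        simp only [Fin.mk_one, Matrix.cons_val_one, Matrix.cons_val_zero, this]
        exact b.2
      · exact V.smul_mem k⁻¹ v.2
    · rw [(flexPlane_mem_planeSet f1 f2).1, hdim]
  · left
    have hex' : ¬ ∃ w, g w = 0 ∧ f w ≠ 0 := fun h => hex
      (by
        obtain ⟨w, h1, h2⟩ := exists_in_left_factor hG hF hdim (fun w => (hFG w).symm)
          (fun w h1 h2 => h0 w h2 h1) h
        exact ⟨w, h2, h1⟩)
    push Not at hex hex'
    have hdim' : Module.finrank ℂ V = Module.finrank ℂ E3 := by simp [hdim]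
    let φ : V ≃ₗ[ℂ] E3 := LinearEquiv.ofInjectiveOfFinrankEq f
      (by
        rw [← LinearMap.ker_eq_bot, LinearMap.ker_eq_bot']
        exact fun w hw => h0 w hw (hex w hw)) hdim'
    let ψ : V ≃ₗ[ℂ] E3 := LinearEquiv.ofInjectiveOfFinrankEq g
      (by
        rw [← LinearMap.ker_eq_bot, LinearMap.ker_eq_bot']
        exact fun w hw => h0 w (hex' w hw) hw) hdim'
    have hφ : ∀ w, φ w = f w := fun w => rfl
    have hψ : ∀ w, ψ w = g w := fun w => rfl
    refine ⟨φ.symm.trans ψ, fun x => ?_, ?_⟩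
    · rw [LinearEquiv.trans_apply, hψ, ← hFG, ← hφ, φ.apply_symm_apply]
    · ext v
      rw [LinearMap.mem_graph_iff, LinearEquiv.coe_coe, LinearEquiv.trans_apply]
      constructor
      · intro hv
        have : φ ⟨v, hv⟩ = v.1 := rfl
        rw [← this, φ.symm_apply_apply]
        rfl
      · intro hv
        have h1 : v = φ.symm v.1 := Prod.ext
          (by
            have := φ.apply_symm_apply v.1
            rw [hφ] at this
            exact this.symm) hv
        rw [h1]
        exact (φ.symm v.1).2

/-- The number of planes in `F x = G y`: the graphs of isomorphisms, and `9 · 9 · 3` planes given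
by a flex of `F`, a flex of `G` and a cube root of unity. -/
theorem ncard_planeSet {F G : E3 → ℂ} (hF : SmoothCubic F) (hG : SmoothCubic G)
    (hF9 : HasNineFlexes F) (hG9 : HasNineFlexes G) (hfin : Finite (Isos F G)) :
    (planeSet F G).ncard = 243 + Nat.card (Isos F G) := by
  obtain ⟨ι, p, q, hι, hfr, hinj, hall⟩ := hF9
  obtain ⟨κ, p', q', hκ, hfr', hinj', hall'⟩ := hG9
  have hfι : Finite ι := Nat.finite_of_card_ne_zero (by rw [hι]; norm_num)
  have hfκ : Finite κ := Nat.finite_of_card_ne_zero (by rw [hκ]; norm_num)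
  have hμ : Nat.card {z : ℂ // z ^ 3 = 1} = 3 := natCard_pow_eq_one (by norm_num)
  have hfμ : Finite {z : ℂ // z ^ 3 = 1} := Nat.finite_of_card_ne_zero (by rw [hμ]; norm_num)
  let gr : Isos F G → Submodule ℂ (E3 × E3) := fun e => (e.1 : E3 →ₗ[ℂ] E3).graph
  let fp : ι × κ × {z : ℂ // z ^ 3 = 1} → Submodule ℂ (E3 × E3) := fun x =>
    flexPlane (p x.1) (q x.1) (p' x.2.1) ((x.2.2 : ℂ) • q' x.2.1)
  have hω0 : ∀ z : {z : ℂ // z ^ 3 = 1}, (z : ℂ) ≠ 0 := by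
    rintro ⟨z, hz⟩ h0
    simp only at h0
    rw [h0] at hz
    norm_num at hz
  have hfrω : ∀ j (z : {z : ℂ // z ^ 3 = 1}), FlexFrame G (p' j) ((z : ℂ) • q' j) := by
    intro j z
    refine ⟨?_, fun s t => ?_⟩
    · have := (hfr' j).1
      rw [LinearIndependent.pair_iff] at this ⊢
      intro s t hst
      rw [smul_smul] at hst
      simpa [hω0 z] using this _ _ hst
    · rw [smul_smul, (hfr' j).2, mul_pow, z.2, mul_one]
  have hgr : Function.Injective gr := by
    intro e e' h
    apply Subtype.ext
    ext1 x
    have : (x, e.1 x) ∈ gr e' := by rw [← h]; exact rfl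
    exact this
  have hfp : Function.Injective fp := by
    rintro ⟨i, j, z⟩ ⟨i', j', z'⟩ h
    have hq' : ∀ {b c : ℂ}, 0 = b • p' j' + c • (z' : ℂ) • q' j' → c = 0 := fun {b c} hbc =>
      (LinearIndependent.pair_iff.mp (hfrω j' z').1 _ _ hbc.symm).2
    obtain rfl : i = i' := by
      have : ((p i, 0) : E3 × E3) ∈ fp (i', j', z') := by
        rw [← h]
        exact mem_flexPlane.mpr ⟨1, 0, 0, by simp, by simp⟩
      obtain ⟨a, b, c, h1, h2⟩ := mem_flexPlane.mp this
      rw [hq' h2, zero_smul, add_zero] at h1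
      exact hinj _ _ _ h1
    obtain rfl : j = j' := by
      have : ((0, p' j) : E3 × E3) ∈ fp (i, j', z') := by
        rw [← h]
        exact mem_flexPlane.mpr ⟨0, 1, 0, by simp, by simp⟩
      obtain ⟨a, b, c, h1, h2⟩ := mem_flexPlane.mp this
      obtain ⟨-, rfl⟩ := LinearIndependent.pair_iff.mp (hfr i).1 _ _ h1.symm
      rw [zero_smul, add_zero] at h2
      exact hinj' _ _ _ h2
    have : ((q i, (z : ℂ) • q' j) : E3 × E3) ∈ fp (i, j, z') := by
      rw [← h]
      exact mem_flexPlane.mpr ⟨0, 0, 1, by simp, by simp⟩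
    obtain ⟨a, b, c, h1, h2⟩ := mem_flexPlane.mp this
    simp only at h1 h2
    have hc := (LinearIndependent.pair_iff.mp (hfr i).1 a (c - 1)
      (by rw [sub_smul, one_smul, ← add_sub_assoc, ← h1, sub_self])).2
    rw [sub_eq_zero.mp hc, one_smul] at h2
    have hz := (LinearIndependent.pair_iff.mp (hfr' j).1 b (z' - z)
      (by rw [sub_smul, ← add_sub_assoc, ← h2, sub_self])).2
    obtain rfl : z = z' := Subtype.ext (sub_eq_zero.mp hz).symm
    rfl
  have hunion : planeSet F G = Set.range fp ∪ Set.range gr := by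
    ext V
    constructor
    · intro hV
      rcases mem_planeSet_cases hF hG hV with ⟨e, he, rfl⟩ | ⟨x, y, x', y', h1, h2, rfl⟩
      · exact Or.inr ⟨⟨e, he⟩, rfl⟩
      · left
        obtain ⟨i, ⟨c, hc⟩, a, b, hab⟩ := hall _ _ h1
        obtain ⟨j, ⟨c', hc'⟩, a', b', hab'⟩ := hall' _ _ h2
        have hb : b ^ 3 = 1 := by
          rw [← (hfr i).2 a b, ← hab]
          simpa using h1.2 0 1
        have hb' : b' ^ 3 = 1 := by
          rw [← (hfr' j).2 a' b', ← hab']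
          simpa using h2.2 0 1
        have hb0 : b ≠ 0 := by rintro rfl; norm_num at hb
        have hc0 : c ≠ 0 := by rintro rfl; exact h1.1.ne_zero 0 (by simpa using hc)
        have hc0' : c' ≠ 0 := by rintro rfl; exact h2.1.ne_zero 0 (by simpa using hc')
        have hz : (b' / b) ^ 3 = 1 := by rw [div_pow, hb, hb', div_one]
        refine ⟨(i, j, ⟨b' / b, hz⟩), Submodule.eq_of_le_of_finrank_eq ?_ ?_⟩
        · intro v hv
          obtain ⟨r, s, t, e1, e2⟩ := mem_flexPlane.mp hv
          refine mem_flexPlane.mpr ⟨(r - t * a / b) / c, (s - t * a' / b) / c', t / b, ?_, ?_⟩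
          · simp only at e1
            rw [e1, hc, hab, smul_smul, smul_add, smul_smul, smul_smul, div_mul_cancel₀ _ hc0,
              div_mul_cancel₀ _ hb0]
            module
          · simp only at e2
            rw [e2, hc', hab', smul_smul ((s - t * a' / b) / c'), div_mul_cancel₀ _ hc0']
            module
        · rw [(flexPlane_mem_planeSet (hfr i) (hfrω j _)).1, hV.1]
    · rintro (⟨⟨i, j, z⟩, rfl⟩ | ⟨e, rfl⟩)
      · exact flexPlane_mem_planeSet (hfr i) (hfrω j z)
      · refine ⟨?_, fun v hv => ?_⟩
        · change Module.finrank ℂ (e.1 : E3 →ₗ[ℂ] E3).graph = 3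
          rw [LinearMap.graph_eq_range_prod, LinearMap.finrank_range_of_inj]
          · simp
          · exact fun x y hxy => congrArg Prod.fst hxy
        · rw [show v.2 = e.1 v.1 from hv, e.2]
  have hdisj : Disjoint (Set.range fp) (Set.range gr) := by
    rw [Set.disjoint_left]
    rintro - ⟨⟨i, j, z⟩, rfl⟩ ⟨e, he⟩
    have : ((0, p' j) : E3 × E3) ∈ gr e := by
      rw [he]
      exact mem_flexPlane.mpr ⟨0, 1, 0, by simp, by simp⟩
    have h0 : p' j = e.1 0 := this
    rw [LinearEquiv.map_zero] at h0
    exact (hfr' j).1.ne_zero 0 h0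
  rw [hunion, Set.ncard_union_eq hdisj (Set.finite_range _) (Set.finite_range _),
    ← Nat.card_coe_set_eq, ← Nat.card_coe_set_eq, Nat.card_range_of_injective hfp,
    Nat.card_range_of_injective hgr, Nat.card_prod, Nat.card_prod, hι, hκ, hμ]

/-! ### From projective planes to linear subspaces -/

theorem eval_diffPoly (F₁ F₂ : MvPolynomial (Fin 3) ℂ) (v : Fin 3 ⊕ Fin 3 → ℂ) :
    eval v (diffPoly F₁ F₂) = eval (v ∘ Sum.inl) F₁ - eval (v ∘ Sum.inr) F₂ := by
  simp [diffPoly, eval_rename]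

theorem coe_subset_zeroLocus_iff {σ : Type} {G : MvPolynomial σ ℂ} (hG : eval (0 : σ → ℂ) G = 0)
    (S : Projectivization.Subspace ℂ (σ → ℂ)) :
    (S : Set (Projectivization ℂ (σ → ℂ))) ⊆ zeroLocus G ↔
      ∀ v ∈ Projectivization.Subspace.submodule S, eval v G = 0 := by
  constructor
  · intro h v hv
    by_cases hv0 : v = 0
    · rw [hv0, hG]
    · refine h ((Projectivization.Subspace.mem_submodule_iff S hv0).mp hv) v ?_
      rw [Projectivization.submodule_mk]
      exact Submodule.mem_span_singleton_self v
  · intro h x hx v hv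
    induction x using Projectivization.ind with
    | h w hw =>
      rw [Projectivization.submodule_mk] at hv
      obtain ⟨c, rfl⟩ := Submodule.mem_span_singleton.mp hv
      exact h _ (Submodule.smul_mem _ c
        ((Projectivization.Subspace.mem_submodule_iff S hw).mpr hx))

theorem ncard_planesIn {F₁ F₂ : MvPolynomial (Fin 3) ℂ}
    (h0 : eval (0 : E3) F₁ = 0) (h0' : eval (0 : E3) F₂ = 0) :
    (planesIn (CubicFourfold.zeroLocus (diffPoly F₁ F₂))).ncard =
      (planeSet (fun x => eval x F₁) (fun x => eval x F₂)).ncard := by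
  let e := LinearEquiv.sumArrowLequivProdArrow (Fin 3) (Fin 3) ℂ ℂ
  let φ : Projectivization.Subspace ℂ (Fin 3 ⊕ Fin 3 → ℂ) ≃o Submodule ℂ (E3 × E3) :=
    Projectivization.Subspace.submodule.trans (Submodule.orderIsoMapComap e)
  have hφ : ∀ S, φ S = (Projectivization.Subspace.submodule S).map (e : _ →ₗ[ℂ] E3 × E3) :=
    fun S => rfl
  have hG : eval (0 : Fin 3 ⊕ Fin 3 → ℂ) (diffPoly F₁ F₂) = 0 := by
    rw [eval_diffPoly]
    change eval (0 : E3) F₁ - eval (0 : E3) F₂ = 0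
    rw [h0, h0', sub_zero]
  have himage : φ '' planesIn (CubicFourfold.zeroLocus (diffPoly F₁ F₂)) =
      planeSet (fun x => eval x F₁) (fun x => eval x F₂) := by
    have hiff : ∀ S, S ∈ planesIn (CubicFourfold.zeroLocus (diffPoly F₁ F₂)) ↔
        φ S ∈ planeSet (fun x => eval x F₁) (fun x => eval x F₂) := by
      intro S
      change (_ ∧ _) ↔ (_ ∧ _)
      rw [coe_subset_zeroLocus_iff hG, hφ, LinearEquiv.finrank_map_eq]
      refine and_congr_right fun _ => ⟨?_, fun h v hv => ?_⟩
      · rintro h - ⟨v, hv, rfl⟩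
        have := h v hv
        rw [eval_diffPoly, sub_eq_zero] at this
        exact this
      · rw [eval_diffPoly, sub_eq_zero]
        exact h (e v) ⟨v, hv, rfl⟩
    ext V
    constructor
    · rintro ⟨S, hS, rfl⟩
      exact (hiff S).mp hS
    · intro hV
      obtain ⟨S, rfl⟩ := φ.surjective V
      exact ⟨S, (hiff S).mpr hV, rfl⟩
  rw [← himage, Set.ncard_image_of_injective _ φ.injective]

theorem eval_pderiv_diffPoly_inl (F₁ F₂ : MvPolynomial (Fin 3) ℂ) (i : Fin 3)
    (v : Fin 3 ⊕ Fin 3 → ℂ) :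
    eval v (pderiv (Sum.inl i) (diffPoly F₁ F₂)) = eval (v ∘ Sum.inl) (pderiv i F₁) := by
  have h : pderiv (Sum.inl i : Fin 3 ⊕ Fin 3) (rename Sum.inr F₂) = 0 := by
    classical
    apply pderiv_eq_zero_of_notMem_vars
    intro hi
    obtain ⟨j, -, hj⟩ := Finset.mem_image.mp (vars_rename _ _ hi)
    exact Sum.inr_ne_inl hj
  rw [diffPoly, map_sub, h, sub_zero, pderiv_rename Sum.inl_injective, eval_rename]

theorem eval_pderiv_diffPoly_inr (F₁ F₂ : MvPolynomial (Fin 3) ℂ) (i : Fin 3)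
    (v : Fin 3 ⊕ Fin 3 → ℂ) :
    eval v (pderiv (Sum.inr i) (diffPoly F₁ F₂)) = - eval (v ∘ Sum.inr) (pderiv i F₂) := by
  have h : pderiv (Sum.inr i : Fin 3 ⊕ Fin 3) (rename Sum.inl F₁) = 0 := by
    classical
    apply pderiv_eq_zero_of_notMem_vars
    intro hi
    obtain ⟨j, -, hj⟩ := Finset.mem_image.mp (vars_rename _ _ hi)
    exact Sum.inl_ne_inr hj
  rw [diffPoly, map_sub, h, zero_sub, pderiv_rename Sum.inr_injective, map_neg, eval_rename]

/-- The Jacobian criterion, in terms of formal partial derivatives. -/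
theorem smoothCubic_of_pderiv {F : MvPolynomial (Fin 3) ℂ} (hF : F.IsHomogeneous 3)
    (h : ∀ v : E3, (∀ i, eval v (pderiv i F) = 0) → v = 0) : SmoothCubic (fun x => eval x F) := by
  obtain ⟨B, hB, h1, -⟩ := exists_isPolarization hF
  refine ⟨B, hB, fun v hv => h v fun i => ?_⟩
  rw [h1, hv, mul_zero]

theorem eval_zero_of_isHomogeneous {F : MvPolynomial (Fin 3) ℂ} (hF : F.IsHomogeneous 3) :
    eval (0 : E3) F = 0 := by
  obtain ⟨B, hB, -⟩ := exists_isPolarization hF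
  simpa using hB.diag 0

theorem eval_eq_zero_of_pderiv {F : MvPolynomial (Fin 3) ℂ} (hF : F.IsHomogeneous 3) {v : E3}
    (h : ∀ i, eval v (pderiv i F) = 0) : eval v F = 0 := by
  have := congrArg (eval v) hF.sum_X_mul_pderiv
  simpa [h] using this

theorem smoothCubic_left_of_diffPoly {F₁ F₂ : MvPolynomial (Fin 3) ℂ} (h₁ : F₁.IsHomogeneous 3)
    (h₂ : F₂.IsHomogeneous 3) (h : IsSmoothHypersurface (diffPoly F₁ F₂)) :
    SmoothCubic (fun x => eval x F₁) := by
  refine smoothCubic_of_pderiv h₁ fun v hv => ?_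
  by_contra hv0
  have hl : (Sum.elim v 0 : Fin 3 ⊕ Fin 3 → ℂ) ∘ Sum.inl = v := Sum.elim_comp_inl _ _
  have hr : (Sum.elim v 0 : Fin 3 ⊕ Fin 3 → ℂ) ∘ Sum.inr = 0 := Sum.elim_comp_inr _ _
  obtain ⟨i | i, hi⟩ := h (Sum.elim v 0) (fun h0 => hv0 (by rw [← hl, h0]; rfl))
    (by rw [eval_diffPoly, hl, hr, eval_eq_zero_of_pderiv h₁ hv, eval_zero_of_isHomogeneous h₂,
      sub_zero])
  · rw [eval_pderiv_diffPoly_inl, hl] at hi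
    exact hi (hv i)
  · obtain ⟨B, -, hB, -⟩ := exists_isPolarization h₂
    rw [eval_pderiv_diffPoly_inr, hr, hB] at hi
    simp at hi

theorem smoothCubic_right_of_diffPoly {F₁ F₂ : MvPolynomial (Fin 3) ℂ} (h₁ : F₁.IsHomogeneous 3)
    (h₂ : F₂.IsHomogeneous 3) (h : IsSmoothHypersurface (diffPoly F₁ F₂)) :
    SmoothCubic (fun x => eval x F₂) := by
  refine smoothCubic_of_pderiv h₂ fun v hv => ?_
  by_contra hv0
  have hl : (Sum.elim 0 v : Fin 3 ⊕ Fin 3 → ℂ) ∘ Sum.inl = 0 := Sum.elim_comp_inl _ _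
  have hr : (Sum.elim 0 v : Fin 3 ⊕ Fin 3 → ℂ) ∘ Sum.inr = v := Sum.elim_comp_inr _ _
  obtain ⟨i | i, hi⟩ := h (Sum.elim 0 v) (fun h0 => hv0 (by rw [← hr, h0]; rfl))
    (by rw [eval_diffPoly, hl, hr, eval_eq_zero_of_pderiv h₂ hv, eval_zero_of_isHomogeneous h₁,
      sub_zero])
  · obtain ⟨B, -, hB, -⟩ := exists_isPolarization h₁
    rw [eval_pderiv_diffPoly_inl, hl, hB] at hi
    simp at hi
  · rw [eval_pderiv_diffPoly_inr, hr] at hi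
    exact hi (by simpa using hv i)

/-! ### Weierstrass equations and the `j`-invariant -/

theorem equivalent_iff {F G : MvPolynomial (Fin 3) ℂ} :
    Equivalent F G ↔ (Isos (fun x => eval x G) (fun x => eval x F)).Nonempty := by
  constructor
  · rintro ⟨g, hg⟩
    refine ⟨LinearMap.GeneralLinearGroup.generalLinearEquiv ℂ E3
      (Matrix.GeneralLinearGroup.toLin g), fun x => ?_⟩
    beta_reduce
    rw [← hg x]
    rfl
  · rintro ⟨e, he⟩
    refine ⟨Matrix.GeneralLinearGroup.toLin.symm
      ((LinearMap.GeneralLinearGroup.generalLinearEquiv ℂ E3).symm e), fun x => ?_⟩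
    have hmul : ∀ g : GL (Fin 3) ℂ, (g : Matrix (Fin 3) (Fin 3) ℂ).mulVec x =
        LinearMap.GeneralLinearGroup.generalLinearEquiv ℂ E3
          (Matrix.GeneralLinearGroup.toLin g) x := fun g => rfl
    rw [hmul, MulEquiv.apply_symm_apply, MulEquiv.apply_symm_apply]
    exact he x

/-- A Weierstrass cubic is linearly equivalent to the short one with `a = -c₄/48`,
`b = -c₆/864`. -/
theorem exists_isos_weierstrass_short (W : WeierstrassCurve ℂ) :
    (Isos (fun x => eval x W.toProjective.polynomial)
      (short (-W.c₄ / 48) (-W.c₆ / 864))).Nonempty := by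
  let M : E3 →ₗ[ℂ] E3 :=
    { toFun := fun v => ![v 0 + W.b₂ / 12 * v 2, v 1 + W.a₁ / 2 * v 0 + W.a₃ / 2 * v 2, v 2]
      map_add' := fun u v => by ext i; fin_cases i <;> simp <;> ring
      map_smul' := fun c v => by ext i; fin_cases i <;> simp <;> ring }
  have hM : ∀ v, M v = ![v 0 + W.b₂ / 12 * v 2, v 1 + W.a₁ / 2 * v 0 + W.a₃ / 2 * v 2, v 2] :=
    fun v => rfl
  have hinj : Function.Injective M := by
    rw [← LinearMap.ker_eq_bot, LinearMap.ker_eq_bot']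
    intro v hv
    rw [hM] at hv
    have e0 := congrFun hv 0
    have e1 := congrFun hv 1
    have e2 := congrFun hv 2
    simp at e0 e1 e2
    simp [e2] at e0
    simp [e0, e2] at e1
    ext i; fin_cases i
    · exact e0
    · exact e1
    · exact e2
  refine ⟨LinearEquiv.ofInjectiveEndo M hinj, fun v => ?_⟩
  rw [LinearEquiv.coe_ofInjectiveEndo, hM]
  beta_reduce
  rw [WeierstrassCurve.Projective.eval_polynomial]
  simp only [short, Matrix.cons_val, WeierstrassCurve.c₄, WeierstrassCurve.c₆, WeierstrassCurve.b₂,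
    WeierstrassCurve.b₄, WeierstrassCurve.b₆]
  ring

theorem j_eq_zero_iff_c₄ (W : WeierstrassCurve ℂ) [W.IsElliptic] : W.j = 0 ↔ W.c₄ = 0 := by
  rw [WeierstrassCurve.j, Units.mul_right_eq_zero]
  simp

theorem j_eq_1728_iff_c₆ (W : WeierstrassCurve ℂ) [W.IsElliptic] : W.j = 1728 ↔ W.c₆ = 0 := by
  have h : W.Δ ≠ 0 := W.isUnit_Δ.ne_zero
  have hc := W.c_relation
  rw [WeierstrassCurve.j, Units.val_inv_eq_inv_val, WeierstrassCurve.coe_Δ']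
  rw [inv_mul_eq_iff_eq_mul₀ h]
  constructor
  · intro h1
    have : W.c₆ ^ 2 = 0 := by linear_combination hc + h1
    simpa using this
  · intro h1
    rw [h1] at hc
    linear_combination -hc

/-- Every smooth plane cubic has a `j`-invariant. -/
theorem exists_isJInvariant {F : MvPolynomial (Fin 3) ℂ} (hF : F.IsHomogeneous 3)
    (hs : SmoothCubic (fun x => eval x F)) : ∃ j, IsJInvariant F j := by
  obtain ⟨p, q, hpq⟩ := exists_flexFrame hF hs
  obtain ⟨a, b, hab, e, he, -⟩ := hs.exists_short hpq
  let W : WeierstrassCurve ℂ := ⟨0, 0, 0, a, b⟩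
  have hΔ : W.Δ = -16 * (4 * a ^ 3 + 27 * b ^ 2) := by
    simp only [WeierstrassCurve.Δ, WeierstrassCurve.b₂, WeierstrassCurve.b₄, WeierstrassCurve.b₆,
      WeierstrassCurve.b₈, W]
    ring
  have hW : W.IsElliptic := ⟨by
    rw [hΔ, isUnit_iff_ne_zero]
    exact mul_ne_zero (by norm_num) hab⟩
  refine ⟨W.j, W, hW, equivalent_iff.mpr ⟨e.symm, fun x => ?_⟩, rfl⟩
  rw [isos_symm he]
  beta_reduce
  rw [WeierstrassCurve.Projective.eval_polynomial]
  simp only [short, W]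
  ring

/-- Smoothness is invariant under linear changes of coordinates. -/
theorem SmoothCubic.of_isos {F G : E3 → ℂ} {e : E3 ≃ₗ[ℂ] E3} (he : e ∈ Isos F G)
    (hF : SmoothCubic F) : SmoothCubic G := by
  obtain ⟨B, hB, h⟩ := hF
  let e' : E3 →ₗ[ℂ] E3 := e.symm
  refine ⟨(B.compl₁₂ e' e').compr₂ (LinearMap.lcomp ℂ ℂ e'), ⟨fun u v w => ?_, fun u v w => ?_,
    fun x => ?_⟩, fun v hv => ?_⟩
  · exact hB.swap_left _ _ _
  · exact hB.swap_right _ _ _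
  · rw [← isos_symm he]
    exact hB.diag _
  · have := h (e.symm v) fun w => by
      have := hv (e w)
      simpa [e'] using this
    simpa using this

/-- The number of linear automorphisms of a smooth cubic form in terms of its `j`-invariant. -/
theorem natCard_isos_of_isJInvariant {F : MvPolynomial (Fin 3) ℂ}
    (hs : SmoothCubic (fun x => eval x F)) {j : ℂ} (hj : IsJInvariant F j) :
    (j = 0 → Nat.card (Isos (fun x => eval x F) (fun x => eval x F)) = 162) ∧
    (j = 1728 → Nat.card (Isos (fun x => eval x F) (fun x => eval x F)) = 108) ∧
    (j ≠ 0 ∧ j ≠ 1728 → Nat.card (Isos (fun x => eval x F) (fun x => eval x F)) = 54) := by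
  obtain ⟨W, hW, hFW, rfl⟩ := hj
  obtain ⟨e, he⟩ := equivalent_iff.mp hFW
  obtain ⟨f, hf⟩ := exists_isos_weierstrass_short W
  have hef := isos_trans (isos_symm he) hf
  have hΔ : 4 * (-W.c₄ / 48) ^ 3 + 27 * (-W.c₆ / 864) ^ 2 ≠ 0 := by
    have h : W.Δ ≠ 0 := W.isUnit_Δ.ne_zero
    have hc := W.c_relation
    intro h0
    refine h ?_
    linear_combination hc / 1728 - 16 * h0
  obtain ⟨h1, h2, h3⟩ := natCard_isos_short hΔ (SmoothCubic.of_isos hef hs)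
  rw [natCard_isos_congr hef hef]
  simp only [ne_eq, j_eq_zero_iff_c₄, j_eq_1728_iff_c₆]
  refine ⟨fun h => h1 ?_, fun h => h2 ?_, fun h => h3 ?_ ?_⟩
  · rw [h]; simp
  · rw [h]; simp
  · simpa [j_eq_zero_iff_c₄] using h.1
  · simpa [j_eq_1728_iff_c₆] using h.2

/-! ### The Hesse cubic with `j = 1728` -/

theorem isHomogeneous_hesse (c : ℂ) : (hesse c).IsHomogeneous 3 := by
  have h : (C (3 * c) * X 0 * X 1 * X 2 : MvPolynomial (Fin 3) ℂ).IsHomogeneous (0 + 1 + 1 + 1) :=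
    (((isHomogeneous_C _ _).mul (isHomogeneous_X _ _)).mul (isHomogeneous_X _ _)).mul
      (isHomogeneous_X _ _)
  exact (((isHomogeneous_X_pow _ _).add (isHomogeneous_X_pow _ _)).add
    (isHomogeneous_X_pow _ _)).sub h

theorem eval_hesse (c : ℂ) (v : E3) :
    eval v (hesse c) = v 0 ^ 3 + v 1 ^ 3 + v 2 ^ 3 - 3 * c * v 0 * v 1 * v 2 := by
  simp [hesse]

theorem hesse_singular {c : ℂ} (hc : c ^ 3 ≠ 1) {v : E3}
    (h : ∀ i, eval v (pderiv i (hesse c)) = 0) : v = 0 := by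
  have h0 := h 0
  have h1 := h 1
  have h2 := h 2
  simp [hesse, pderiv_X] at h0 h1 h2
  have e0 : v 0 ^ 2 = c * v 1 * v 2 := by linear_combination h0 / 3
  have e1 : v 1 ^ 2 = c * v 0 * v 2 := by linear_combination h1 / 3
  have e2 : v 2 ^ 2 = c * v 0 * v 1 := by linear_combination h2 / 3
  have hprod : (1 - c ^ 3) * (v 0 * v 1 * v 2) ^ 2 = 0 := by
    linear_combination v 1 ^ 2 * v 2 ^ 2 * e0 + c * v 1 * v 2 * v 2 ^ 2 * e1 +
      c ^ 2 * v 0 * v 1 * v 2 ^ 2 * e2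
  have hxyz : v 0 * v 1 * v 2 = 0 := by
    have := (mul_eq_zero.mp hprod).resolve_left (sub_ne_zero.mpr hc.symm)
    exact pow_eq_zero_iff two_ne_zero |>.mp this
  ext i
  refine pow_eq_zero_iff three_ne_zero |>.mp ?_
  fin_cases i
  · change v 0 ^ 3 = 0
    linear_combination v 0 * e0 + c * hxyz
  · change v 1 ^ 3 = 0
    linear_combination v 1 * e1 + c * hxyz
  · change v 2 ^ 3 = 0
    linear_combination v 2 * e2 + c * hxyz

theorem isSmoothHypersurface_diffPoly_hesse {c : ℂ} (hc : c ^ 3 ≠ 1) :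
    IsSmoothHypersurface (diffPoly (hesse c) (hesse c)) := by
  intro v hv _
  by_contra hcon
  push Not at hcon
  have hl : v ∘ Sum.inl = 0 := hesse_singular hc fun i => by
    rw [← eval_pderiv_diffPoly_inl _ (hesse c)]
    exact hcon _
  have hr : v ∘ Sum.inr = 0 := hesse_singular hc fun i => by
    have := hcon (Sum.inr i)
    rwa [eval_pderiv_diffPoly_inr, neg_eq_zero] at this
  apply hv
  ext (i | i)
  · exact congrFun hl i
  · exact congrFun hr i

/-- The Hesse cubic has `j = 1728` if `c⁶ - 20 c³ - 8 = 0`. With `u = x₀ + x₁`, `v = x₀ - x₁`,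
`z = x₂` and the flex tangent `w = u + c z` at `(1 : -1 : 0)`, it is
`(3/4) v² w + (1 - c³) z³ + (9c²/4) z² w - (3c/2) z w² + w³/4`, and the condition on `c` says that
after completing the cube in `z` there is no term in `w³`. -/
theorem isJInvariant_hesse {c : ℂ} (hc : c ^ 6 - 20 * c ^ 3 - 8 = 0) :
    IsJInvariant (hesse c) 1728 := by
  have hc0 : c ≠ 0 := by rintro rfl; norm_num at hc
  obtain ⟨k, hk⟩ : ∃ k, k = 1 - c ^ 3 := ⟨_, rfl⟩
  have hk0 : k ≠ 0 := by
    intro h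
    have h3 : c ^ 3 = 1 := by linear_combination hk - h
    rw [show c ^ 6 = (c ^ 3) ^ 2 by ring, h3] at hc
    norm_num at hc
  have h8 : 8 + c ^ 3 ≠ 0 := by
    intro h
    have h3 : c ^ 3 = -8 := by linear_combination h
    rw [show c ^ 6 = (c ^ 3) ^ 2 by ring, h3] at hc
    norm_num at hc
  obtain ⟨m, hm⟩ : ∃ m, m = -(3 * c ^ 2) / (4 * k) := ⟨_, rfl⟩
  have hm1 : 4 * k * m = -(3 * c ^ 2) := by rw [hm]; field_simp
  obtain ⟨β, hβ⟩ := IsAlgClosed.exists_pow_nat_eq (4 / 3 : ℂ) (n := 2) two_pos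
  obtain ⟨α, hα⟩ := IsAlgClosed.exists_pow_nat_eq (-1 / k) (n := 3) three_pos
  have hβ0 : β ≠ 0 := by rintro rfl; norm_num at hβ
  have hα1 : k * α ^ 3 = -1 := by rw [hα]; field_simp
  have hα0 : α ≠ 0 := by rintro rfl; norm_num at hα1
  have hconst : k * m ^ 3 + 9 * c ^ 2 / 4 * m ^ 2 - 3 * c / 2 * m + 1 / 4 = 0 := by
    rw [hm]
    field_simp
    rw [hk]
    linear_combination (-4 : ℂ) * hc
  obtain ⟨r, hr⟩ : ∃ r, r = 3 * k * m ^ 2 + 9 * c ^ 2 / 2 * m - 3 * c / 2 := ⟨_, rfl⟩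
  have hr0 : r ≠ 0 := by
    intro h
    have : c * (8 + c ^ 3) = 0 := by
      rw [hr, hm] at h
      field_simp at h
      rw [hk] at h
      linear_combination (-1 / 6 : ℂ) * h
    exact mul_ne_zero hc0 h8 this
  let W : WeierstrassCurve ℂ := ⟨0, 0, 0, -(α * r), 0⟩
  have hΔ : W.Δ = 64 * (α * r) ^ 3 := by
    simp only [WeierstrassCurve.Δ, WeierstrassCurve.b₂, WeierstrassCurve.b₄, WeierstrassCurve.b₆,
      WeierstrassCurve.b₈, W]
    ring
  have hW : W.IsElliptic := ⟨by
    rw [hΔ, isUnit_iff_ne_zero]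
    exact mul_ne_zero (by norm_num) (pow_ne_zero 3 (mul_ne_zero hα0 hr0))⟩
  have hj : W.j = 1728 := by
    rw [j_eq_1728_iff_c₆]
    simp [WeierstrassCurve.c₆, WeierstrassCurve.b₂, WeierstrassCurve.b₄, WeierstrassCurve.b₆, W]
  let M : E3 →ₗ[ℂ] E3 :=
    { toFun := fun x => ![(x 2 - c * (α * x 0 + m * x 2) + β * x 1) / 2,
        (x 2 - c * (α * x 0 + m * x 2) - β * x 1) / 2, α * x 0 + m * x 2]
      map_add' := fun u v => by ext i; fin_cases i <;> simp <;> ring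
      map_smul' := fun c v => by ext i; fin_cases i <;> simp <;> ring }
  have hM : ∀ x, M x = ![(x 2 - c * (α * x 0 + m * x 2) + β * x 1) / 2,
      (x 2 - c * (α * x 0 + m * x 2) - β * x 1) / 2, α * x 0 + m * x 2] := fun x => rfl
  have hinj : Function.Injective M := by
    rw [← LinearMap.ker_eq_bot, LinearMap.ker_eq_bot']
    intro x hx
    rw [hM] at hx
    have e0 := congrFun hx 0
    have e1 := congrFun hx 1
    have e2 := congrFun hx 2
    simp only [Matrix.cons_val, Pi.zero_apply] at e0 e1 e2
    have x2 : x 2 = 0 := by linear_combination e0 + e1 + c * e2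
    have x1 : β * x 1 = 0 := by linear_combination e0 - e1
    have x0 : α * x 0 = 0 := by linear_combination e2 - m * x2
    ext i; fin_cases i
    · simpa [hα0] using x0
    · simpa [hβ0] using x1
    · exact x2
  refine ⟨W, hW, equivalent_iff.mpr ⟨LinearEquiv.ofInjectiveEndo M hinj, fun x => ?_⟩, hj⟩
  rw [LinearEquiv.coe_ofInjectiveEndo, hM]
  beta_reduce
  rw [WeierstrassCurve.Projective.eval_polynomial, eval_hesse]
  simp only [W, Matrix.cons_val]
  rw [hr]
  rw [hk] at hα1 hm1 hconst ⊢
  linear_combination (3 / 4 * x 1 ^ 2 * x 2) * hβ + x 0 ^ 3 * hα1 +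
    (3 / 4 * α ^ 2 * x 0 ^ 2 * x 2) * hm1 + x 2 ^ 3 * hconst

theorem one_add_sqrt_three_pow : (1 + (Real.sqrt 3 : ℂ)) ^ 6 - 20 * (1 + (Real.sqrt 3 : ℂ)) ^ 3 - 8
    = 0 := by
  have h : (Real.sqrt 3 : ℂ) ^ 2 = 3 := by
    rw [← Complex.ofReal_pow, Real.sq_sqrt (by norm_num)]
    norm_num
  generalize (Real.sqrt 3 : ℂ) = s at h
  have h3 : (1 + s) ^ 3 = 10 + 6 * s := by linear_combination (s + 3) * h
  rw [show (1 + s) ^ 6 = ((1 + s) ^ 3) ^ 2 by ring, h3]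
  linear_combination 36 * h

/-- The number of planes in `F₁ = F₂` for smooth cubic forms: `243` plus the number of linear
isomorphisms between `F₁` and `F₂`. -/
theorem ncard_planesIn_eq {F₁ F₂ : MvPolynomial (Fin 3) ℂ} (h₁ : F₁.IsHomogeneous 3)
    (h₂ : F₂.IsHomogeneous 3) (hs : IsSmoothHypersurface (diffPoly F₁ F₂))
    (hfin : Finite (Isos (fun x => eval x F₁) (fun x => eval x F₂))) :
    (planesIn (CubicFourfold.zeroLocus (diffPoly F₁ F₂))).ncard =
      243 + Nat.card (Isos (fun x => eval x F₁) (fun x => eval x F₂)) := by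
  have s₁ := smoothCubic_left_of_diffPoly h₁ h₂ hs
  have s₂ := smoothCubic_right_of_diffPoly h₁ h₂ hs
  obtain ⟨p, q, hpq⟩ := exists_flexFrame h₁ s₁
  obtain ⟨p', q', hpq'⟩ := exists_flexFrame h₂ s₂
  rw [ncard_planesIn s₁.map_zero s₂.map_zero, ncard_planeSet s₁ s₂ (s₁.hasNineFlexes hpq)
    (s₂.hasNineFlexes hpq') hfin]

/-- The number of planes in `F₁ = F₂` for linearly equivalent smooth cubic forms, in terms of the
`j`-invariant of `F₁`. -/
theorem ncard_planesIn_of_equivalent {F₁ F₂ : MvPolynomial (Fin 3) ℂ} (h₁ : F₁.IsHomogeneous 3)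
    (h₂ : F₂.IsHomogeneous 3) (hs : IsSmoothHypersurface (diffPoly F₁ F₂))
    (heq : Equivalent F₁ F₂) {j : ℂ} (hj : IsJInvariant F₁ j) :
    (j = 0 → (planesIn (CubicFourfold.zeroLocus (diffPoly F₁ F₂))).ncard = 243 + 162) ∧
    (j = 1728 → (planesIn (CubicFourfold.zeroLocus (diffPoly F₁ F₂))).ncard = 243 + 108) ∧
    (j ≠ 0 ∧ j ≠ 1728 →
      (planesIn (CubicFourfold.zeroLocus (diffPoly F₁ F₂))).ncard = 243 + 54) := by
  obtain ⟨e, he⟩ := equivalent_iff.mp heq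
  have hrefl : LinearEquiv.refl ℂ E3 ∈ Isos (fun x => eval x F₁) (fun x => eval x F₁) :=
    fun x => rfl
  have hcard := natCard_isos_congr hrefl he
  obtain ⟨c1, c2, c3⟩ := natCard_isos_of_isJInvariant (smoothCubic_left_of_diffPoly h₁ h₂ hs) hj
  rw [← hcard] at c1 c2 c3
  have key : ∀ n : ℕ, n ≠ 0 → Nat.card (Isos (fun x => eval x F₁) (fun x => eval x F₂)) = n →
      (planesIn (CubicFourfold.zeroLocus (diffPoly F₁ F₂))).ncard = 243 + n := by
    intro n hn h
    rw [ncard_planesIn_eq h₁ h₂ hs (Nat.finite_of_card_ne_zero (by rwa [h])), h]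
  exact ⟨fun h => key _ (by norm_num) (c1 h), fun h => key _ (by norm_num) (c2 h),
    fun h => key _ (by norm_num) (c3 h)⟩

theorem Equivalent.symm {F G : MvPolynomial (Fin 3) ℂ} (h : Equivalent F G) : Equivalent G F := by
  obtain ⟨e, he⟩ := equivalent_iff.mp h
  exact equivalent_iff.mpr ⟨e.symm, isos_symm he⟩

theorem IsJInvariant.of_equivalent {F G : MvPolynomial (Fin 3) ℂ} (h : Equivalent F G) {j : ℂ}
    (hj : IsJInvariant G j) : IsJInvariant F j := by
  obtain ⟨W, hW, hGW, rfl⟩ := hj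
  obtain ⟨e, he⟩ := equivalent_iff.mp h
  obtain ⟨f, hf⟩ := equivalent_iff.mp hGW
  exact ⟨W, hW, equivalent_iff.mpr ⟨f.trans e, isos_trans hf he⟩, rfl⟩

end CubicFourfold

theorem corollary1p3 :
    (∀ F₁ F₂ : MvPolynomial (Fin 3) ℂ, F₁.IsHomogeneous 3 → F₂.IsHomogeneous 3 →
      CubicFourfold.IsSmoothHypersurface (CubicFourfold.diffPoly F₁ F₂) →
      (CubicFourfold.Equivalent F₁ F₂ →
        (∃ j : ℂ, CubicFourfold.IsJInvariant F₁ j ∧ CubicFourfold.IsJInvariant F₂ j) ∧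
        ∀ j : ℂ, (CubicFourfold.IsJInvariant F₁ j ∨ CubicFourfold.IsJInvariant F₂ j) →
          (j = 0 →
            (CubicFourfold.planesIn (CubicFourfold.zeroLocus
              (CubicFourfold.diffPoly F₁ F₂))).ncard = 243 + 162) ∧
          (j = 1728 →
            (CubicFourfold.planesIn (CubicFourfold.zeroLocus
              (CubicFourfold.diffPoly F₁ F₂))).ncard = 243 + 108) ∧
          (j ≠ 0 ∧ j ≠ 1728 →
            (CubicFourfold.planesIn (CubicFourfold.zeroLocus
              (CubicFourfold.diffPoly F₁ F₂))).ncard = 243 + 54)) ∧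
      (¬ CubicFourfold.Equivalent F₁ F₂ →
        (CubicFourfold.planesIn (CubicFourfold.zeroLocus
          (CubicFourfold.diffPoly F₁ F₂))).ncard = 243)) ∧
    (∀ H : MvPolynomial (Fin 3) ℂ,
      H = CubicFourfold.hesse (1 + (Real.sqrt 3 : ℂ)) →
        H.IsHomogeneous 3 ∧
        CubicFourfold.IsSmoothHypersurface (CubicFourfold.diffPoly H H) ∧
        CubicFourfold.IsJInvariant H 1728 ∧
        (CubicFourfold.planesIn (CubicFourfold.zeroLocus
          (CubicFourfold.diffPoly H H))).ncard = 351) := by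
  refine ⟨fun F₁ F₂ h₁ h₂ hs => ⟨fun heq => ⟨?_, ?_⟩, fun hne => ?_⟩, ?_⟩
  · obtain ⟨j, hj⟩ := CubicFourfold.exists_isJInvariant h₁
      (CubicFourfold.smoothCubic_left_of_diffPoly h₁ h₂ hs)
    exact ⟨j, hj, hj.of_equivalent heq.symm⟩
  · intro j hj
    exact CubicFourfold.ncard_planesIn_of_equivalent h₁ h₂ hs heq
      (hj.elim id fun h => h.of_equivalent heq)
  · have hempty : IsEmpty (CubicFourfold.Isos (fun x => MvPolynomial.eval x F₁)
        (fun x => MvPolynomial.eval x F₂)) :=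
      ⟨fun e => hne (CubicFourfold.Equivalent.symm
        (CubicFourfold.equivalent_iff.mpr ⟨e.1, e.2⟩))⟩
    rw [CubicFourfold.ncard_planesIn_eq h₁ h₂ hs inferInstance, Nat.card_of_isEmpty]
  · rintro H rfl
    have hc := CubicFourfold.one_add_sqrt_three_pow
    have hc1 : (1 + (Real.sqrt 3 : ℂ)) ^ 3 ≠ 1 := by
      intro h
      rw [show (1 + (Real.sqrt 3 : ℂ)) ^ 6 = ((1 + (Real.sqrt 3 : ℂ)) ^ 3) ^ 2 by ring, h] at hc
      norm_num at hc
    have hh := CubicFourfold.isHomogeneous_hesse (1 + (Real.sqrt 3 : ℂ))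
    have hs := CubicFourfold.isSmoothHypersurface_diffPoly_hesse hc1
    have hj := CubicFourfold.isJInvariant_hesse hc
    refine ⟨hh, hs, hj, ?_⟩
    exact (CubicFourfold.ncard_planesIn_of_equivalent hh hh hs
      (CubicFourfold.equivalent_iff.mpr ⟨LinearEquiv.refl ℂ _, fun x => rfl⟩) hj).2.1 rfl
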